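/- Let $\Sigma$ be a finite alphabet. A (finite, complete, deterministic) semiautomaton with input alphabet $\Sigma$ consists of a finite set $Q$ of states and a transition function $\delta\colon Q\times\Sigma\to Q$; words act on $Q$ letter by letter from left to right, and $Qw=\{qw : q\in Q\}$. For $k\ge 1$, a word $w\in\Sigma^+$ is $k$-compressing for the semiautomaton if $|Q|-|Qw|\ge k$; the semiautomaton is $k$-compressible if it has a $k$-compressing word; and $w\in\Sigma^+$ is $k$-collapsing if it is $k$-compressing for every $k$-compressible semiautomaton with input alphabet $\Sigma$. A word is $k$-full if every word of length $k$ over $\Sigma$ is a factor (contiguous subword) of it. Let $c(k,t)$ be the length of a shortest $k$-collapsing word over an alphabet of $t$ letters. The dual of a word over $\{a,b\}$ is obtained by interchanging $a$ and $b$, and the dual of a language is the set of duals of its words. Let $$W=\{ab^2ab^2a,\ ab^2a^2b^2a,\ abab^2aba,\ ab^3aba,\ abab^3a,\ ab^3ab^3a,\ ba^2baba^2b,\ a^2b^3a,\ ba^2ba^2b,$$ $$ba^2b^2a^2b,\ baba^2bab,\ ba^3bab,\ baba^3b,\ ba^3ba^3b,\ ab^2abab^2a,\ b^2a^3b,\ a^2b^3a^2,\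 b^2a^3b^2\},$$ let $W'=W\setminus\{a^2b^3a^2,\,b^2a^3b^2\}$, let $\mathcal L=b(a^+b)^*(ba)^+a(ba)^*ab(b+ab^2)$ (a regular language, $+$ in the last bracket denoting union), and let $$w_3=b^2a^3b\cdot a^3b^3aba^2\cdot baba^2ba^2b^2a^2b^2ab^2aba\cdot b^2aba^3bab^3\cdot ab^3a .$$ Then: 1. Every $3$-full word over $\{a,b\}$ that has all words of $W$ as factors is $3$-collapsing. 2. For all $u\in\mathcal L$ and all $v$ in the dual of $\mathcal L$, every $3$-full word over $\{a,b\}$ that has $u$, $v$ and all words of $W'$ as factors is $3$-collapsing. 3. The word $w_3$ has length $53$, is $3$-full, has as factors all words of $W'$ as well as $u=b^2aba^3bab^2\in\mathcal L$ and $v=a^2b^3aba^2$, which lies in the dual of $\mathcal L$; and $w_3$ is $3$-collapsing. 4. Consequently $c(3,2)\le 53$. -/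

import Mathlib

namespace CollapsingWords

open Computability

/-- A complete deterministic semiautomaton with state set `Q` and input alphabet `α` is given by its
transition function `δ : Q → α → Q`; this is the action of words on states, letters being read from
left to right: `q (x₁ x₂ … xₙ) = (… ((q x₁) x₂) …) xₙ`. -/
def act {Q α : Type} (δ : Q → α → Q) (w : List α) (q : Q) : Q :=
  w.foldl δ q

/-- The deficiency `|Q| - |Qw|` (the subtraction never truncates when `Q` is finite). -/
noncomputable def deficiency {Q α : Type} (δ : Q → α → Q) (w : List α) : ℕ :=
  Nat.card Q - (Set.range (act δ w)).ncard

/-- `w ∈ Σ⁺` is `k`-compressing for the automaton `δ`. -/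
def IsCompressing {Q α : Type} (k : ℕ) (δ : Q → α → Q) (w : List α) : Prop :=
  w ≠ [] ∧ k ≤ deficiency δ w

/-- The automaton `δ` is `k`-compressible. -/
def IsCompressible {Q α : Type} (k : ℕ) (δ : Q → α → Q) : Prop :=
  ∃ w : List α, IsCompressing k δ w

/-- `w ∈ Σ⁺` is `k`-collapsing: it is `k`-compressing for every `k`-compressible finite automaton
with input alphabet `α`. -/
def IsCollapsing {α : Type} (k : ℕ) (w : List α) : Prop :=
  w ≠ [] ∧ ∀ (Q : Type) [Finite Q] (δ : Q → α → Q), IsCompressible k δ → IsCompressing k δ w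

/-- `w` is `k`-full: every word of length `k` is a factor of `w`. -/
def IsFull {α : Type} (k : ℕ) (w : List α) : Prop :=
  ∀ x : List α, x.length = k → x <:+: w

/-- `c(k,t)`: the length of a shortest `k`-collapsing word over an alphabet of `t` letters
(`⊤` if there were no such word). -/
noncomputable def c (k t : ℕ) : ℕ∞ :=
  ⨅ w ∈ {w : List (Fin t) | IsCollapsing k w}, (w.length : ℕ∞)

/-- The two letters of the binary alphabet. -/
abbrev a : Fin 2 := 0

/-- The two letters of the binary alphabet. -/
abbrev b : Fin 2 := 1

/-- The dual of a word: `a` and `b` are interchanged. -/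
def dual (w : List (Fin 2)) : List (Fin 2) :=
  w.map (Equiv.swap a b)

/-- The set `W` of eighteen words. -/
def W : Finset (List (Fin 2)) :=
  {[a, b, b, a, b, b, a],
   [a, b, b, a, a, b, b, a],
   [a, b, a, b, b, a, b, a],
   [a, b, b, b, a, b, a],
   [a, b, a, b, b, b, a],
   [a, b, b, b, a, b, b, b, a],
   [b, a, a, b, a, b, a, a, b],
   [a, a, b, b, b, a],
   [b, a, a, b, a, a, b],
   [b, a, a, b, b, a, a, b],
   [b, a, b, a, a, b, a, b],
   [b, a, a, a, b, a, b],
   [b, a, b, a, a, a, b],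
   [b, a, a, a, b, a, a, a, b],
   [a, b, b, a, b, a, b, b, a],
   [b, b, a, a, a, b],
   [a, a, b, b, b, a, a],
   [b, b, a, a, a, b, b]}

/-- `W` without `a²b³a²` and `b²a³b²`. -/
def W' : Finset (List (Fin 2)) :=
  W \ {[a, a, b, b, b, a, a], [b, b, a, a, a, b, b]}

/-- The regular language `𝓛 = b (a⁺b)* (ba)⁺ a (ba)* ab (b + ab²)`. -/
def L : Language (Fin 2) :=
  {[b]} * ({[a]} * {[a]}∗ * {[b]})∗ * ({[b, a]} * {[b, a]}∗) * {[a]} * {[b, a]}∗ * {[a, b]} *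
    ({[b]} + {[a, b, b]})

/-- The dual language of `𝓛`. -/
def dualL : Language (Fin 2) :=
  {w | dual w ∈ L}

/-- `u = b²aba³bab²`. -/
def u : List (Fin 2) :=
  [b, b, a, b, a, a, a, b, a, b, b]

/-- `v = a²b³aba²`. -/
def v : List (Fin 2) :=
  [a, a, b, b, b, a, b, a, a]

/-- `w₃ = b²a³b · a³b³aba² · baba²ba²b²a²b²ab²aba · b²aba³bab³ · ab³a`. -/
def w₃ : List (Fin 2) :=
  [b, b, a, a, a, b] ++
  [a, a, a, b, b, b, a, b, a, a] ++
  [b, a, b, a, a, b, a, a, b, b, a, a, b, b, a, b, b, a, b, a] ++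
  [b, b, a, b, a, a, a, b, a, b, b, b] ++
  [a, b, b, b, a]

end CollapsingWords

/-! Deficiency cannot decrease when a word is extended on either side. If a word containing all the
tested factors had deficiency at most two for some automaton, so would each of these factors. It
therefore suffices that an automaton with deficiency at most two on all words of length three, on
`W'`, on one member of `L` and on one member of `dualL` has deficiency at most two on every word
(`SmallOnTests.deficiency_le`).

A state is missed by `wx` exactly when all its `x`-preimages are missed by `w` (`missing_concat`).
The evolution of missing sets thus depends only on the gaps and fibres of the letters and on their
values at a few states. Since the square of each letter has deficiency at most two, each letter has
one of five shapes (`exists_shape`). For each pair of shapes and each way in which their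
distinguished states can coincide, a search branches on the value of a needed transition: an already
named state or a new one. This covers automata of every size by finitely many symbolic cases.

A branch is contradictory if the named missing states force deficiency three on a tested word. It is
also contradictory if they do so on all words of `L`, or on all words of `dualL`; whole languages
must be refuted because the tested members are arbitrary. Otherwise a branch ends when an upper
approximation of the missing sets is closed under both letters and never allows three elements
(`ncard_le_two_of_isClosed`). Correctness of the search is `search_sound`; its runs are evaluated by
the kernel, and duality halves the work. -/

namespace CollapsingWords

/-! ### The symbolic search procedure -/

/-- A partially known self-map of a finite set whose elements are named by numbers: `gap` lists the
elements outside the range, `ker` the nontrivial fibres, and `tr` some known values, recorded at the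
heads of the fibres. -/
structure PartialMap where
  gap : List ℕ
  ker : List (List ℕ)
  tr : List (ℕ × ℕ)

/-- A partially known semiautomaton over the binary alphabet with `size` named states. -/
structure PartialAutomaton where
  size : ℕ
  onA : PartialMap
  onB : PartialMap

/-- Membership in a list of numbers. -/
def elem (m : ℕ) (K : List ℕ) : Bool :=
  K.any (Nat.beq m)

/-- Equality of lists of numbers. -/
def same : List ℕ → List ℕ → Bool
  | [], [] => true
  | m :: K, n :: L => Nat.beq m n && same K L
  | _, _ => false

namespace PartialMap

/-- The known value at `r`. -/
def value (l : PartialMap) (r : ℕ) : Option ℕ :=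
  (l.tr.find? fun t => Nat.beq t.1 r).map Prod.snd

/-- `r` is not a member of a nontrivial fibre other than its head. -/
def isHead (l : PartialMap) (r : ℕ) : Bool :=
  l.ker.all fun C => !elem r C || Nat.beq (C.headD 0) r

/-- The heads of the fibres that are contained in `K`. -/
def reps (l : PartialMap) (K : List ℕ) : List ℕ :=
  K.filter fun m => l.ker.all fun C => !elem m C || (Nat.beq (C.headD 0) m && C.all (elem · K))

/-- The known part of the missing set after a step from a missing set containing `K`. -/
def image (l : PartialMap) (K : List ℕ) : List ℕ :=
  l.gap ++ (l.reps K).filterMap l.value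

/-- The number of elements of `K` that yield missing elements without a known name. -/
def unknown (l : PartialMap) (K : List ℕ) : ℕ :=
  ((l.reps K).filter fun r => (l.value r).isNone).length

/-- A step from a missing set containing `K` leads to a missing set of at least three elements. -/
def exceeds (l : PartialMap) (K : List ℕ) : Bool :=
  Nat.ble 3 (l.gap.length + (l.reps K).length)

end PartialMap

namespace PartialAutomaton

/-- The partial map of a letter. -/
def on (P : PartialAutomaton) (x : Fin 2) : PartialMap :=
  match x with
  | 0 => P.onA
  | 1 => P.onB

/-- Record that the letter `x` sends `r` to `j`, where `j` may be a new name. -/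
def assign (P : PartialAutomaton) (x : Fin 2) (r j : ℕ) : PartialAutomaton :=
  let n := bif Nat.beq j P.size then P.size + 1 else P.size
  match x with
  | 0 => ⟨n, { P.onA with tr := (r, j) :: P.onA.tr }, P.onB⟩
  | 1 => ⟨n, P.onA, { P.onB with tr := (r, j) :: P.onB.tr }⟩

/-- An abstract state `(K, k)` stands for the sets that contain `K` and at most `k` further
elements. The search closes the abstract states under the letters and succeeds if none of them
allows more than two elements. -/
def closeLoop (P : PartialAutomaton) :
    ℕ → List (List ℕ × ℕ) → List (List ℕ × ℕ) → Bool
  | 0, _, _ => false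
  | _ + 1, [], _ => true
  | f + 1, s :: todo, seen =>
    bif Nat.ble (s.1.length + s.2) 2 then
      bif seen.any (fun t => Nat.beq s.2 t.2 && same s.1 t.1) then closeLoop P f todo seen
      else closeLoop P f
        ((P.onA.image s.1, s.2 + P.onA.unknown s.1) ::
          (P.onB.image s.1, s.2 + P.onB.unknown s.1) :: todo) (s :: seen)
    else false

/-- No word can reach a missing set of more than two elements. -/
def isClosed (P : PartialAutomaton) : Bool :=
  -- The fuel only limits the exploration: running out of it counts as failure, so correctness does
  -- not depend on the number 60.
  P.closeLoop 60 [([], 0)] []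

/-- Read `w` from a missing set containing `K` as far as the transitions are known; `none` means
that a missing set of at least three elements occurs. -/
def advance (P : PartialAutomaton) : List ℕ → List (Fin 2) → Option (List ℕ × List (Fin 2))
  | K, [] => some (K, [])
  | K, x :: w =>
    bif (P.on x).exceeds K then none
    else bif Nat.beq ((P.on x).unknown K) 0 then advance P ((P.on x).image K) w
    else some (K, x :: w)

/-- Advance all pending words and drop those that were read completely. -/
def advanceAll (P : PartialAutomaton) :
    List (List ℕ × List (Fin 2)) → Option (List (List ℕ × List (Fin 2)))
  | [] => some []
  | s :: l =>
    match P.advance s.1 s.2 with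
    | none => none
    | some t =>
      match advanceAll P l with
      | none => none
      | some l' => some (bif t.2.isEmpty then l' else t :: l')

/-- A transition whose value is needed for the first pending word. -/
def needed (P : PartialAutomaton) : List (List ℕ × List (Fin 2)) → Fin 2 × ℕ
  | (K, x :: _) :: _ =>
    (x, (((P.on x).reps K).find? fun r => ((P.on x).value r).isNone).getD 0)
  | _ => (0, 0)

/-- The given words as far as their reading is blocked by an unknown transition. -/
def pending (P : PartialAutomaton) (ws : List (List (Fin 2))) : List (List ℕ × List (Fin 2)) :=
  ws.filterMap fun w => (P.advance [] w).filter fun t => !t.2.isEmpty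

/-- The known parts of the missing sets of at most two elements after reading a word that matches a
regular expression; the list `[[]]` carries no information. -/
def post (P : PartialAutomaton) : RegularExpression (Fin 2) → List (List ℕ) → List (List ℕ)
  | .zero, _ => []
  | .epsilon, T => T
  | .char x, T =>
    T.filterMap fun K => bif (P.on x).exceeds K then none else some ((P.on x).image K)
  | .plus R S, T => post P R T ++ post P S T
  | .comp R S, T => post P S (post P R T)
  | .star R, T =>
    -- Six rounds of saturation are a heuristic bound; the test that follows decides whether the
    -- result is really stable under `R`.
    let T' := (fun U => (post P R U).foldl (fun V K => bif V.any (same K) then V else K :: V) U)^[6] T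
    bif (post P R T').all fun K => T'.any (same K) then T' else [[]]

/-- The symbolic search: it succeeds if every automaton extending `P` either has no word of
deficiency three, or attains deficiency three on one of the pending words or on all the words
matching one of the regular expressions. The words `guide` only direct the search. -/
def search (Rs : List (RegularExpression (Fin 2))) (guide : List (List (Fin 2))) :
    ℕ → PartialAutomaton → List (List ℕ × List (Fin 2)) → Bool
  | 0, _, _ => false
  | f + 1, P, items =>
    match P.advanceAll items with
    | none => true
    | some items' =>
      P.isClosed || (items'.isEmpty && Rs.any (fun R => (P.post R [[]]).isEmpty)) ||
        let xr := P.needed (bif items'.isEmpty then P.pending guide else items')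
        let l := P.on xr.1
        -- These checks make correctness independent of how `needed` and the guide words choose the
        -- transition.
        (Nat.blt xr.2 P.size && l.isHead xr.2 && (l.value xr.2).isNone) &&
          (List.range (P.size + 1)).all fun j =>
            -- A value in the gap is impossible, and so is a value already attained at another fibre
            -- head. The index `j = P.size` stands for a state without a name so far.
            elem j l.gap || (l.tr.any fun t => Nat.beq t.2 j) ||
              search Rs guide f (P.assign xr.1 xr.2 j) items'

end PartialAutomaton
end CollapsingWords

/-! ### Missing sets and monotonicity of the deficiency -/

namespace CollapsingWords

variable {Q : Type}

/-- The states that are missed by a word. -/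
def missing {α : Type} (δ : Q → α → Q) (w : List α) : Set Q :=
  (Set.range (act δ w))ᶜ

/-- The missing set after applying `f` when `S` was missing before. -/
def next (f : Q → Q) (S : Set Q) : Set Q :=
  {q | ∀ p, f p = q → p ∈ S}

theorem act_append {α : Type} (δ : Q → α → Q) (w x : List α) (q : Q) :
    act δ (w ++ x) q = act δ x (act δ w q) := by
  simp [act]

theorem missing_nil {α : Type} (δ : Q → α → Q) : missing δ [] = ∅ := by
  ext q
  simp [missing, act]

theorem missing_concat {α : Type} (δ : Q → α → Q) (w : List α) (x : α) :
    missing δ (w ++ [x]) = next (δ · x) (missing δ w) := by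
  ext q
  simp only [missing, next, Set.mem_compl_iff, Set.mem_range, Set.mem_ofPred_eq, act_append]
  simp only [act, List.foldl_cons, List.foldl_nil]
  constructor
  · rintro h p hp ⟨y, hy⟩
    exact h ⟨y, by rw [hy, hp]⟩
  · rintro h ⟨y, hy⟩
    exact h _ hy ⟨y, rfl⟩

theorem deficiency_eq {α : Type} [Finite Q] (δ : Q → α → Q) (w : List α) :
    deficiency δ w = (missing δ w).ncard := by
  rw [deficiency, missing, Set.ncard_compl]

theorem deficiency_le_append_right {α : Type} [Finite Q] (δ : Q → α → Q) (w x : List α) :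
    deficiency δ w ≤ deficiency δ (w ++ x) := by
  have h : Set.range (act δ (w ++ x)) = act δ x '' Set.range (act δ w) := by
    rw [← Set.range_comp]
    congr 1
    ext q
    exact act_append δ w x q
  have := Set.ncard_image_le (f := act δ x) (Set.toFinite (Set.range (act δ w)))
  rw [deficiency, deficiency, h]
  omega

theorem deficiency_le_append_left {α : Type} [Finite Q] (δ : Q → α → Q) (w x : List α) :
    deficiency δ x ≤ deficiency δ (w ++ x) := by
  have h : Set.range (act δ (w ++ x)) ⊆ Set.range (act δ x) := by
    rintro _ ⟨q, rfl⟩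
    exact ⟨_, (act_append δ w x q).symm⟩
  have := Set.ncard_le_ncard h (Set.toFinite _)
  rw [deficiency, deficiency]
  omega

theorem deficiency_le_of_infix {α : Type} [Finite Q] (δ : Q → α → Q) {x w : List α}
    (h : x <:+: w) : deficiency δ x ≤ deficiency δ w := by
  obtain ⟨s, t, rfl⟩ := h
  exact (deficiency_le_append_left δ s x).trans (deficiency_le_append_right δ _ t)

theorem elem_iff {m : ℕ} {K : List ℕ} : elem m K = true ↔ m ∈ K := by
  simp [elem]

theorem same_iff : ∀ {K L : List ℕ}, same K L = true ↔ K = L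
  | [], [] => by simp [same]
  | [], _ :: _ => by simp [same]
  | _ :: _, [] => by simp [same]
  | m :: K, n :: L => by simp [same, same_iff (K := K) (L := L)]

theorem ncard_list_image_le (g : ℕ → Q) (K : List ℕ) :
    {q | ∃ i ∈ K, g i = q}.ncard ≤ K.length := by
  classical
  have h : {q | ∃ i ∈ K, g i = q} = ((K.map g).toFinset : Set Q) := by
    ext q
    simp
  rw [h, Set.ncard_coe_finset]
  exact (List.toFinset_card_le _).trans (by simp)

theorem length_le_ncard [Finite Q] {K : List Q} {S : Set Q} (hK : K.Nodup)
    (h : ∀ q ∈ K, q ∈ S) : K.length ≤ S.ncard := by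
  classical
  rw [← List.toFinset_card_of_nodup hK, ← Set.ncard_coe_finset]
  exact Set.ncard_le_ncard (by intro q; simpa using h q) (Set.toFinite _)

/-- Discarding the unknown values of a partial map only deletes entries from the list of true
values, so distinctness is inherited by the named part. -/
theorem map_filterMap_sublist {g : ℕ → Option ℕ} {ι h : ℕ → Q} :
    ∀ {K : List ℕ}, (∀ r ∈ K, ∀ j, g r = some j → ι j = h r) →
      ((K.filterMap g).map ι).Sublist (K.map h)
  | [], _ => by simp
  | r :: K, hg => by
    have ih := map_filterMap_sublist (K := K) fun s hs => hg s (by simp [hs])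
    cases hr : g r with
    | none => simpa [List.filterMap_cons, hr] using ih.cons (h r)
    | some j =>
      simpa [List.filterMap_cons, hr, hg r (by simp) j hr] using ih

/-! ### Correctness of a single symbolic step -/

namespace PartialMap

theorem isHead_iff {l : PartialMap} {r : ℕ} :
    l.isHead r = true ↔ ∀ C ∈ l.ker, r ∈ C → C.headD 0 = r := by
  simp only [isHead, List.all_eq_true, Bool.or_eq_true, Bool.not_eq_true', Nat.beq_eq]
  refine forall₂_congr fun C _ => ?_
  rw [← elem_iff]
  cases elem r C <;> simp

theorem mem_reps {l : PartialMap} {K : List ℕ} {m : ℕ} :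
    m ∈ l.reps K ↔ m ∈ K ∧ ∀ C ∈ l.ker, m ∈ C → C.headD 0 = m ∧ ∀ c ∈ C, c ∈ K := by
  simp only [reps, List.mem_filter, List.all_eq_true, Bool.or_eq_true, Bool.not_eq_true',
    Bool.and_eq_true, Nat.beq_eq, elem_iff]
  refine and_congr_right fun _ => forall₂_congr fun C _ => ?_
  rw [← elem_iff]
  cases elem m C <;> simp

theorem mem_tr_of_value {l : PartialMap} {r j : ℕ} (h : l.value r = some j) : (r, j) ∈ l.tr := by
  obtain ⟨t, ht, rfl⟩ := Option.map_eq_some_iff.1 h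
  have h1 := List.find?_some ht
  have h2 := List.mem_of_find?_eq_some ht
  rw [Nat.beq_eq] at h1
  rwa [← h1]

theorem ne_of_value_none {l : PartialMap} {r : ℕ} (h : l.value r = none) {t : ℕ × ℕ}
    (ht : t ∈ l.tr) : t.1 ≠ r := by
  have := List.find?_eq_none.1 (Option.map_eq_none_iff.1 h) t ht
  simpa using this

/-- `f` is described by `l` when the number `i < n` names the state `ι i`. -/
structure Models (ι : ℕ → Q) (n : ℕ) (l : PartialMap) (f : Q → Q) : Prop where
  inj : ∀ i < n, ∀ j < n, ι i = ι j → i = j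
  gap_lt : ∀ i ∈ l.gap, i < n
  gap_nodup : l.gap.Nodup
  mem_gap : ∀ q, (∀ p, f p ≠ q) ↔ ∃ i ∈ l.gap, ι i = q
  ker_lt : ∀ C ∈ l.ker, ∀ i ∈ C, i < n
  ker_disjoint : ∀ C ∈ l.ker, ∀ D ∈ l.ker, ∀ i ∈ C, i ∈ D → C = D
  fiber : ∀ p q, f p = f q ↔
    p = q ∨ ∃ C ∈ l.ker, (∃ i ∈ C, ι i = p) ∧ ∃ i ∈ C, ι i = q
  tr_lt : ∀ t ∈ l.tr, t.1 < n ∧ t.2 < n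
  tr_head : ∀ t ∈ l.tr, l.isHead t.1 = true
  tr_eq : ∀ t ∈ l.tr, f (ι t.1) = ι t.2

/-- `K` is a list of distinct names of elements of `S`. -/
structure Known (ι : ℕ → Q) (n : ℕ) (K : List ℕ) (S : Set Q) : Prop where
  nodup : K.Nodup
  lt : ∀ i ∈ K, i < n
  mem : ∀ i ∈ K, ι i ∈ S

theorem Known.nil (ι : ℕ → Q) (n : ℕ) (S : Set Q) : Known ι n [] S :=
  ⟨by simp, by simp, by simp⟩

namespace Models

variable {ι : ℕ → Q} {n : ℕ} {l : PartialMap} {f : Q → Q} {K : List ℕ} {S : Set Q}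

/-- A fibre has only one head. Hence values recorded at heads are pairwise distinct, which justifies
excluding values already taken. -/
theorem eq_of_isHead (h : Models ι n l f) {r s : ℕ} (hr : r < n) (hs : s < n)
    (hr' : l.isHead r = true) (hs' : l.isHead s = true) (e : f (ι r) = f (ι s)) : r = s := by
  rcases (h.fiber _ _).1 e with e | ⟨C, hC, ⟨i, hi, ei⟩, j, hj, ej⟩
  · exact h.inj _ hr _ hs e
  · have hi' := h.inj _ (h.ker_lt C hC i hi) _ hr ei
    have hj' := h.inj _ (h.ker_lt C hC j hj) _ hs ej
    subst hi' hj'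
    exact (isHead_iff.1 hr' C hC hi).symm.trans (isHead_iff.1 hs' C hC hj)

theorem isHead_of_mem_reps {r : ℕ} (hr : r ∈ l.reps K) : l.isHead r = true :=
  isHead_iff.2 fun C hC hi => ((mem_reps.1 hr).2 C hC hi).1

theorem mem_next_of_mem_reps (h : Models ι n l f) (hlt : ∀ i ∈ K, i < n) (hS : ∀ i ∈ K, ι i ∈ S)
    {r : ℕ} (hr : r ∈ l.reps K) : f (ι r) ∈ next f S := by
  intro p hp
  obtain ⟨hrK, hr⟩ := mem_reps.1 hr
  rcases (h.fiber _ _).1 hp with e | ⟨C, hC, ⟨i, hi, ei⟩, j, hj, ej⟩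
  · exact e ▸ hS r hrK
  · have := h.inj _ (h.ker_lt C hC j hj) _ (hlt r hrK) ej
    subst this
    exact ei ▸ hS i ((hr C hC hj).2 i hi)

theorem mem_next_of_mem_gap (h : Models ι n l f) {i : ℕ} (hi : i ∈ l.gap) : ι i ∈ next f S :=
  fun p hp => absurd hp ((h.mem_gap _).2 ⟨i, hi, rfl⟩ p)

theorem map_image_sublist (h : Models ι n l f) (K : List ℕ) :
    ((l.image K).map ι).Sublist (l.gap.map ι ++ (l.reps K).map fun r => f (ι r)) := by
  rw [image, List.map_append]
  exact (List.Sublist.refl _).append <| map_filterMap_sublist fun r _ j hj =>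
    (h.tr_eq _ (mem_tr_of_value hj)).symm

theorem mem_next_of_mem (h : Models ι n l f) (hlt : ∀ i ∈ K, i < n) (hS : ∀ i ∈ K, ι i ∈ S) :
    ∀ q ∈ l.gap.map ι ++ (l.reps K).map fun r => f (ι r), q ∈ next f S := by
  intro q hq
  rcases List.mem_append.1 hq with hq | hq
  · obtain ⟨i, hi, rfl⟩ := List.mem_map.1 hq
    exact h.mem_next_of_mem_gap hi
  · obtain ⟨r, hr, rfl⟩ := List.mem_map.1 hq
    exact h.mem_next_of_mem_reps hlt hS hr

/-- Gap states lie outside the range, and distinct heads have distinct images. Counting this list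
gives a lower bound for the next missing set even when some of the images have no name. -/
theorem nodup_map_gap_append (h : Models ι n l f) (hK : K.Nodup) (hlt : ∀ i ∈ K, i < n) :
    (l.gap.map ι ++ (l.reps K).map fun r => f (ι r)).Nodup := by
  refine List.Nodup.append ?_ ?_ ?_
  · exact h.gap_nodup.map_on fun i hi j hj => h.inj i (h.gap_lt i hi) j (h.gap_lt j hj)
  · refine (hK.filter _).map_on fun r hr s hs e => ?_
    exact h.eq_of_isHead (hlt r (mem_reps.1 hr).1) (hlt s (mem_reps.1 hs).1)
      (isHead_of_mem_reps hr) (isHead_of_mem_reps hs) e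
  · intro q hq hq'
    obtain ⟨i, hi, rfl⟩ := List.mem_map.1 hq
    obtain ⟨r, _, e⟩ := List.mem_map.1 hq'
    exact (h.mem_gap _).2 ⟨i, hi, rfl⟩ _ e

theorem image_lt (h : Models ι n l f) : ∀ i ∈ l.image K, i < n := by
  intro i hi
  rcases List.mem_append.1 hi with hi | hi
  · exact h.gap_lt i hi
  · obtain ⟨r, _, hr⟩ := List.mem_filterMap.1 hi
    exact (h.tr_lt _ (mem_tr_of_value hr)).2

theorem image_mem (h : Models ι n l f) (hlt : ∀ i ∈ K, i < n) (hS : ∀ i ∈ K, ι i ∈ S) :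
    ∀ i ∈ l.image K, ι i ∈ next f S := fun _ hi =>
  h.mem_next_of_mem hlt hS _ ((h.map_image_sublist K).subset (List.mem_map_of_mem hi))

theorem known_image (h : Models ι n l f) (hK : Known ι n K S) :
    Known ι n (l.image K) (next f S) :=
  ⟨List.Nodup.of_map ι ((h.nodup_map_gap_append hK.nodup hK.lt).sublist (h.map_image_sublist K)),
    h.image_lt, h.image_mem hK.lt hK.mem⟩

theorem three_le_of_exceeds [Finite Q] (h : Models ι n l f) (hK : Known ι n K S)
    (he : l.exceeds K = true) : 3 ≤ (next f S).ncard := by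
  have := length_le_ncard (h.nodup_map_gap_append hK.nodup hK.lt) (h.mem_next_of_mem hK.lt hK.mem)
  rw [exceeds, Nat.ble_eq] at he
  simp only [List.length_append, List.length_map] at this
  omega

/-- A missing state in the range either has its whole fibre among the named states, and is then the
image of a head in `reps`, or has a preimage that was missing but unnamed. -/
theorem next_subset (h : Models ι n l f) (hlt : ∀ i ∈ K, i < n) {q : Q} (hq : q ∈ next f S) :
    (∃ i ∈ l.gap, ι i = q) ∨ (∃ r ∈ l.reps K, f (ι r) = q) ∨
      q ∈ f '' (S \ {q | ∃ i ∈ K, ι i = q}) := by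
  by_cases hr : ∀ p, f p ≠ q
  · exact .inl ((h.mem_gap q).1 hr)
  push Not at hr
  obtain ⟨p, rfl⟩ := hr
  refine .inr ?_
  by_cases hp : ∀ p', f p' = f p → ∃ i ∈ K, ι i = p'
  · left
    by_cases hC : ∃ C ∈ l.ker, ∃ i ∈ C, ι i = p
    · obtain ⟨C, hC, i, hi, rfl⟩ := hC
      have hsub : ∀ c ∈ C, f (ι c) = f (ι i) := fun c hc =>
        (h.fiber _ _).2 (.inr ⟨C, hC, ⟨c, hc, rfl⟩, i, hi, rfl⟩)
      have hK : ∀ c ∈ C, c ∈ K := fun c hc => by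
        obtain ⟨m, hm, e⟩ := hp _ (hsub c hc)
        exact h.inj _ (hlt m hm) _ (h.ker_lt C hC c hc) e ▸ hm
      have hd : C.headD 0 ∈ C := by
        cases C with
        | nil => simp at hi
        | cons c C => simp
      refine ⟨C.headD 0, mem_reps.2 ⟨hK _ hd, fun D hD hdD => ?_⟩, hsub _ hd⟩
      obtain rfl := h.ker_disjoint C hC D hD _ hd hdD
      exact ⟨rfl, hK⟩
    · obtain ⟨m, hm, rfl⟩ := hp p rfl
      refine ⟨m, mem_reps.2 ⟨hm, fun C hC' hmC => ?_⟩, rfl⟩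
      exact absurd ⟨C, hC', m, hmC, rfl⟩ hC
  · right
    push Not at hp
    obtain ⟨p', e, hp'⟩ := hp
    exact ⟨p', ⟨hq p' e, by rintro ⟨i, hi, e'⟩; exact hp' i hi e'⟩, e⟩

/-- Unnamed missing states arise only as images of unnamed ones or as unknown values at heads in
`reps`. This is the upper bound behind the closure test. -/
theorem ncard_next_diff_le [Finite Q] (h : Models ι n l f) (hlt : ∀ i ∈ K, i < n) :
    (next f S \ {q | ∃ i ∈ l.image K, ι i = q}).ncard ≤
      (S \ {q | ∃ i ∈ K, ι i = q}).ncard + l.unknown K := by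
  have hsub : next f S \ {q | ∃ i ∈ l.image K, ι i = q} ⊆
      f '' (S \ {q | ∃ i ∈ K, ι i = q}) ∪
        {q | ∃ r ∈ (l.reps K).filter fun r => (l.value r).isNone, f (ι r) = q} := by
    rintro q ⟨hq, hq'⟩
    rcases h.next_subset hlt hq with ⟨i, hi, rfl⟩ | ⟨r, hr, rfl⟩ | hq
    · exact absurd ⟨i, List.mem_append_left _ hi, rfl⟩ hq'
    · right
      refine ⟨r, List.mem_filter.2 ⟨hr, ?_⟩, rfl⟩
      cases hv : l.value r with
      | none => rfl
      | some j =>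
        exact absurd ⟨j, List.mem_append_right _ (List.mem_filterMap.2 ⟨r, hr, hv⟩),
          (h.tr_eq _ (mem_tr_of_value hv)).symm⟩ hq'
    · exact .inl hq
  calc _ ≤ _ := Set.ncard_le_ncard hsub (Set.toFinite _)
    _ ≤ _ := Set.ncard_union_le _ _
    _ ≤ _ := Nat.add_le_add (Set.ncard_image_le (Set.toFinite _))
      (ncard_list_image_le (fun r => f (ι r)) _)

/-- Recording a known value keeps the description valid. -/
theorem cons_tr (h : Models ι n l f) {r j : ℕ} (hr : r < n) (hj : j < n)
    (hhead : l.isHead r = true) (e : f (ι r) = ι j) :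
    Models ι n { l with tr := (r, j) :: l.tr } f where
  __ := h
  tr_lt := by
    rintro t (_ | ⟨_, ht⟩)
    exacts [⟨hr, hj⟩, h.tr_lt t ht]
  tr_head := by
    rintro t (_ | ⟨_, ht⟩)
    exacts [hhead, h.tr_head t ht]
  tr_eq := by
    rintro t (_ | ⟨_, ht⟩)
    exacts [e, h.tr_eq t ht]

/-- A description stays valid if the naming is extended. -/
theorem extend (h : Models ι n l f) {κ : ℕ → Q} {m : ℕ} (hnm : n ≤ m)
    (hκ : ∀ i < n, κ i = ι i) (inj : ∀ i < m, ∀ j < m, κ i = κ j → i = j) :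
    Models κ m l f where
  inj := inj
  gap_lt i hi := (h.gap_lt i hi).trans_le hnm
  gap_nodup := h.gap_nodup
  mem_gap q := (h.mem_gap q).trans <| exists_congr fun i => and_congr_right fun hi => by
    rw [hκ i (h.gap_lt i hi)]
  ker_lt C hC i hi := (h.ker_lt C hC i hi).trans_le hnm
  ker_disjoint := h.ker_disjoint
  fiber p q := by
    have key : ∀ C ∈ l.ker, ∀ p, (∃ i ∈ C, κ i = p) ↔ ∃ i ∈ C, ι i = p := fun C hC p =>
      exists_congr fun i => and_congr_right fun hi => by rw [hκ i (h.ker_lt C hC i hi)]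
    rw [h.fiber]
    refine or_congr_right <| exists_congr fun C => and_congr_right fun hC => ?_
    rw [key C hC, key C hC]
  tr_lt t ht := ⟨(h.tr_lt t ht).1.trans_le hnm, (h.tr_lt t ht).2.trans_le hnm⟩
  tr_head := h.tr_head
  tr_eq t ht := by rw [hκ _ (h.tr_lt t ht).1, hκ _ (h.tr_lt t ht).2, h.tr_eq t ht]

end Models
end PartialMap

/-- Extending an injective naming of `n` states by a further state. -/
theorem update_injOn {ι : ℕ → Q} {n : ℕ} (inj : ∀ i < n, ∀ j < n, ι i = ι j → i = j) {q : Q}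
    (hq : ∀ i < n, ι i ≠ q) :
    ∀ i < n + 1, ∀ j < n + 1, Function.update ι n q i = Function.update ι n q j → i = j := by
  intro i hi j hj e
  rcases Nat.lt_succ_iff_lt_or_eq.1 hi with hi | rfl <;>
    rcases Nat.lt_succ_iff_lt_or_eq.1 hj with hj | rfl
  · rw [Function.update_of_ne hi.ne, Function.update_of_ne hj.ne] at e
    exact inj i hi j hj e
  · rw [Function.update_of_ne hi.ne, Function.update_self] at e
    exact absurd e (hq i hi)
  · rw [Function.update_of_ne hj.ne, Function.update_self] at e
    exact absurd e.symm (hq j hj)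
  · rfl

/-! ### Correctness of the search -/

namespace PartialAutomaton

open PartialMap

/-- The automaton `δ` is described by `P` when `i < P.size` names the state `ι i`. -/
def Models (ι : ℕ → Q) (P : PartialAutomaton) (δ : Q → Fin 2 → Q) : Prop :=
  ∀ x, (P.on x).Models ι P.size (δ · x)

variable {ι : ℕ → Q} {P : PartialAutomaton} {δ : Q → Fin 2 → Q}

/-- `S` contains the states named in `s.1` and at most `s.2` further ones. -/
structure Approx (ι : ℕ → Q) (n : ℕ) (s : List ℕ × ℕ) (S : Set Q) : Prop where
  lt : ∀ i ∈ s.1, i < n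
  mem : ∀ i ∈ s.1, ι i ∈ S
  ncard_diff : (S \ {q | ∃ i ∈ s.1, ι i = q}).ncard ≤ s.2

theorem Approx.ncard_le [Finite Q] {n : ℕ} {s : List ℕ × ℕ} {S : Set Q} (h : Approx ι n s S) :
    S.ncard ≤ s.1.length + s.2 := by
  have h1 := Set.ncard_le_ncard_sdiff_add_ncard S {q | ∃ i ∈ s.1, ι i = q}
  have h2 := ncard_list_image_le ι s.1
  have h3 := h.ncard_diff
  omega

/-- The loop invariant is that the successors of every processed abstract state are processed or
still waiting. When nothing is waiting, the processed states are closed under both letters. -/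
theorem closeLoop_closed :
    ∀ {f : ℕ} {todo seen : List (List ℕ × ℕ)}, P.closeLoop f todo seen = true →
      (∀ s ∈ seen, s.1.length + s.2 ≤ 2 ∧ ∀ x,
        ((P.on x).image s.1, s.2 + (P.on x).unknown s.1) ∈ todo ++ seen) →
      ∃ T : List (List ℕ × ℕ), todo ++ seen ⊆ T ∧ ∀ s ∈ T, s.1.length + s.2 ≤ 2 ∧ ∀ x,
        ((P.on x).image s.1, s.2 + (P.on x).unknown s.1) ∈ T
  | 0, _, _, h, _ => by simp [closeLoop] at h
  | f + 1, [], seen, _, hs => ⟨seen, by simp, by simpa using hs⟩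
  | f + 1, s :: todo, seen, h, hs => by
    rw [closeLoop] at h
    cases hle : Nat.ble (s.1.length + s.2) 2 with
    | false => simp [hle] at h
    | true =>
      cases hmem : seen.any (fun t => Nat.beq s.2 t.2 && same s.1 t.1) with
      | true =>
        simp only [hle, hmem, cond_true] at h
        have hs' : s ∈ seen := by
          obtain ⟨t, ht, e⟩ := List.any_eq_true.1 hmem
          rw [Bool.and_eq_true, Nat.beq_eq, same_iff] at e
          rwa [Prod.ext e.2 e.1]
        have hsub : s :: todo ++ seen ⊆ todo ++ seen := by
          intro t ht
          rcases List.mem_cons.1 ht with rfl | ht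
          exacts [List.mem_append_right _ hs', ht]
        obtain ⟨T, hT, hT'⟩ := closeLoop_closed h fun t ht => ⟨(hs t ht).1, fun x =>
          hsub ((hs t ht).2 x)⟩
        exact ⟨T, fun t ht => hT (hsub ht), hT'⟩
      | false =>
        simp only [hle, hmem, cond_true, cond_false] at h
        obtain ⟨T, hT, hT'⟩ := closeLoop_closed h fun t ht => by
          rcases List.mem_cons.1 ht with rfl | ht
          · refine ⟨Nat.le_of_ble_eq_true hle, fun x => ?_⟩
            fin_cases x <;> simp [on]
          · refine ⟨(hs t ht).1, fun x => ?_⟩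
            have := (hs t ht).2 x
            simp only [List.mem_append, List.mem_cons] at this ⊢
            tauto
        refine ⟨T, fun t ht => hT ?_, hT'⟩
        simp only [List.mem_append, List.mem_cons] at ht ⊢
        tauto

theorem ncard_le_two_of_isClosed [Finite Q] (hP : P.Models ι δ) (h : P.isClosed = true)
    (w : List (Fin 2)) : (missing δ w).ncard ≤ 2 := by
  obtain ⟨T, hT, hT'⟩ := closeLoop_closed h (by simp)
  suffices ∃ s ∈ T, Approx ι P.size s (missing δ w) by
    obtain ⟨s, hs, hw⟩ := this
    exact hw.ncard_le.trans (hT' s hs).1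
  induction w using List.reverseRecOn with
  | nil => exact ⟨([], 0), hT (by simp), by simp, by simp, by simp [missing_nil]⟩
  | append_singleton w x ih =>
    obtain ⟨s, hs, hw⟩ := ih
    refine ⟨_, (hT' s hs).2 x, (hP x).image_lt, ?_, ?_⟩
    · rw [missing_concat]
      exact (hP x).image_mem hw.lt hw.mem
    · rw [missing_concat]
      exact ((hP x).ncard_next_diff_le hw.lt).trans (Nat.add_le_add_right hw.ncard_diff _)

theorem three_le_of_append [Finite Q] {w : List (Fin 2)} (x : List (Fin 2))
    (h : 3 ≤ (missing δ w).ncard) : 3 ≤ (missing δ (w ++ x)).ncard := by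
  have := deficiency_le_append_right δ w x
  rw [deficiency_eq, deficiency_eq] at this
  exact h.trans this

/-- A pending word: the named states are missing after a prefix of a word of deficiency at most
two, and the rest of that word is still to be read. -/
def Pending (ι : ℕ → Q) (n : ℕ) (δ : Q → Fin 2 → Q) (s : List ℕ × List (Fin 2)) : Prop :=
  ∃ p, Known ι n s.1 (missing δ p) ∧ (missing δ (p ++ s.2)).ncard ≤ 2

/-- Once three states are missing, appending letters cannot repair this, so a pending word of
deficiency at most two never triggers `exceeds`. -/
theorem advance_sound [Finite Q] (hP : P.Models ι δ) :
    ∀ {w : List (Fin 2)} {K : List ℕ}, Pending ι P.size δ (K, w) →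
      ∃ t, P.advance K w = some t ∧ Pending ι P.size δ t
  | [], K, h => ⟨_, rfl, h⟩
  | x :: w, K, ⟨p, hK, hp⟩ => by
    rw [advance]
    cases he : (P.on x).exceeds K with
    | true =>
      have h3 := (hP x).three_le_of_exceeds hK he
      rw [← missing_concat] at h3
      have := three_le_of_append w h3
      simp only [List.append_assoc, List.singleton_append] at this hp
      omega
    | false =>
      cases hu : Nat.beq ((P.on x).unknown K) 0 with
      | true =>
        simp only [cond_true, cond_false]
        refine advance_sound hP ⟨p ++ [x], ?_, by simpa using hp⟩
        rw [missing_concat]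
        exact (hP x).known_image hK
      | false => exact ⟨_, rfl, p, hK, hp⟩

theorem advanceAll_sound [Finite Q] (hP : P.Models ι δ) :
    ∀ {items : List (List ℕ × List (Fin 2))}, (∀ s ∈ items, Pending ι P.size δ s) →
      ∃ items', P.advanceAll items = some items' ∧ ∀ s ∈ items', Pending ι P.size δ s
  | [], _ => ⟨[], rfl, by simp⟩
  | s :: l, h => by
    obtain ⟨t, ht, ht'⟩ := advance_sound hP (h s (by simp))
    obtain ⟨l', hl, hl'⟩ := advanceAll_sound (items := l) hP fun s hs => h s (by simp [hs])
    refine ⟨bif t.2.isEmpty then l' else t :: l', by rw [advanceAll, ht, hl], ?_⟩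
    cases t.2.isEmpty with
    | true => exact hl'
    | false =>
      intro s hs
      rcases List.mem_cons.1 hs with rfl | hs
      exacts [ht', hl' s hs]

/-- `S` has at least three elements or contains the states named by a member of `T`. -/
def Covered (ι : ℕ → Q) (n : ℕ) (T : List (List ℕ)) (S : Set Q) : Prop :=
  3 ≤ S.ncard ∨ ∃ K ∈ T, Known ι n K S

theorem Covered.mono {n : ℕ} {T T' : List (List ℕ)} {S : Set Q} (h : Covered ι n T S)
    (hT : T ⊆ T') : Covered ι n T' S :=
  h.imp_right fun ⟨K, hK, h⟩ => ⟨K, hT hK, h⟩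

theorem subset_foldl_insert (U : List (List ℕ)) : ∀ V : List (List ℕ),
    V ⊆ U.foldl (fun V K => bif V.any (same K) then V else K :: V) V := by
  induction U with
  | nil => exact fun V => List.Subset.refl V
  | cons K U ih =>
    intro V
    refine List.Subset.trans ?_ (ih _)
    cases h : V.any (same K) <;> simp [h]

/-- Lists with too many missing states may be dropped because the alternative of three missing
elements persists under further letters. An empty result therefore forces deficiency three on every
matching word. -/
theorem post_sound [Finite Q] (hP : P.Models ι δ) (R : RegularExpression (Fin 2)) :
    ∀ {T : List (List ℕ)} {p u : List (Fin 2)}, u ∈ R.matches' →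
      Covered ι P.size T (missing δ p) → Covered ι P.size (P.post R T) (missing δ (p ++ u)) := by
  induction R with
  | zero => exact fun hu => absurd hu (Language.notMem_zero _)
  | epsilon =>
    intro T p u hu h
    obtain rfl : u = [] := hu
    simpa [post] using h
  | char x =>
    intro T p u hu h
    obtain rfl : u = [x] := hu
    rcases h with h | ⟨K, hK, h⟩
    · exact .inl (three_le_of_append _ h)
    · rw [missing_concat]
      cases he : (P.on x).exceeds K with
      | true => exact .inl ((hP x).three_le_of_exceeds h he)
      | false =>
        exact .inr ⟨_, List.mem_filterMap.2 ⟨K, hK, by rw [he]; rfl⟩, (hP x).known_image h⟩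
  | plus R S ihR ihS =>
    intro T p u hu h
    rcases hu with hu | hu
    · exact (ihR hu h).mono (List.subset_append_left _ _)
    · exact (ihS hu h).mono (List.subset_append_right _ _)
  | comp R S ihR ihS =>
    intro T p u hu h
    obtain ⟨v, hv, w, hw, rfl⟩ := Language.mem_mul.1 hu
    rw [← List.append_assoc]
    exact ihS hw (ihR hv h)
  | star R ih =>
    intro T p u hu h
    rw [post]
    set step := fun U => (P.post R U).foldl (fun V K => bif V.any (same K) then V else K :: V) U
    have hsub : ∀ k, ∀ U, U ⊆ step^[k] U := by
      intro k
      induction k with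
      | zero => exact fun U => List.Subset.refl U
      | succ k ihk => exact fun U => List.Subset.trans (subset_foldl_insert _ U) (ihk _)
    set T' := step^[6] T
    cases hc : (P.post R T').all fun K => T'.any (same K) with
    -- If saturation did not stabilise, the result is the empty list of names, which is known for
    -- every set.
    | false => exact .inr ⟨[], by simp, .nil _ _ _⟩
    | true =>
      have hc' : P.post R T' ⊆ T' := by
        intro K hK
        obtain ⟨K', hK', e⟩ := List.any_eq_true.1 (List.all_eq_true.1 hc K hK)
        rwa [same_iff.1 e]
      obtain ⟨L, rfl, hL⟩ := Language.mem_kstar.1 hu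
      -- The induction over the iterated factors needs the stable `T'` as starting point instead of
      -- `T`.
      replace h := h.mono (hsub 6 T)
      clear hu
      simp only [cond_true]
      induction L generalizing p with
      | nil => rwa [List.flatten_nil, List.append_nil]
      | cons v L ihL =>
        rw [List.flatten_cons, ← List.append_assoc]
        exact ihL (fun y hy => hL y (by simp [hy])) ((ih (hL v (by simp)) h).mono hc')

theorem three_le_of_post_isEmpty [Finite Q] (hP : P.Models ι δ) {R : RegularExpression (Fin 2)}
    (h : (P.post R [[]]).isEmpty = true) {u : List (Fin 2)} (hu : u ∈ R.matches') :
    3 ≤ (missing δ u).ncard := by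
  have := post_sound hP R (T := [[]]) (p := []) hu (.inr ⟨[], by simp, .nil _ _ _⟩)
  rw [List.isEmpty_iff.1 h] at this
  simpa [Covered] using this

theorem Models.inj (hP : P.Models ι δ) : ∀ i < P.size, ∀ j < P.size, ι i = ι j → i = j :=
  (hP 0).inj

theorem assign_models_of_lt (hP : P.Models ι δ) {x : Fin 2} {r j : ℕ} (hr : r < P.size)
    (hj : j < P.size) (hhead : (P.on x).isHead r = true) (e : δ (ι r) x = ι j) :
    (P.assign x r j).Models ι δ := by
  have hb : Nat.beq j P.size = false := Bool.eq_false_iff.2 (by simpa using hj.ne)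
  intro y
  fin_cases x <;> fin_cases y <;> simp only [assign, on, hb, cond_false]
  exacts [(hP 0).cons_tr hr hj hhead e, hP 1, hP 0, (hP 1).cons_tr hr hj hhead e]

theorem assign_models_of_new (hP : P.Models ι δ) {x : Fin 2} {r : ℕ} (hr : r < P.size)
    (hhead : (P.on x).isHead r = true) (e : ∀ j < P.size, ι j ≠ δ (ι r) x) :
    (P.assign x r P.size).Models (Function.update ι P.size (δ (ι r) x)) δ := by
  have hκ : ∀ i < P.size, Function.update ι P.size (δ (ι r) x) i = ι i := fun i hi =>
    Function.update_of_ne hi.ne _ _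
  have hext : ∀ y, (P.on y).Models (Function.update ι P.size (δ (ι r) x)) (P.size + 1) (δ · y) :=
    fun y => (hP y).extend (Nat.le_succ _) hκ (update_injOn hP.inj e)
  have hb : Nat.beq P.size P.size = true := by simp
  have hval : δ (Function.update ι P.size (δ (ι r) x) r) x =
      Function.update ι P.size (δ (ι r) x) P.size := by
    rw [hκ r hr, Function.update_self]
  have hr' : r < P.size + 1 := Nat.lt_succ_of_lt hr
  intro y
  fin_cases x <;> fin_cases y <;> simp only [assign, on, hb, cond_true]
  exacts [(hext 0).cons_tr hr' (Nat.lt_succ_self _) hhead hval, hext 1, hext 0,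
    (hext 1).cons_tr hr' (Nat.lt_succ_self _) hhead hval]

/-- The true value of the chosen transition determines one branch: it is a named state, or else it
receives the name `P.size`. That branch cannot have been excluded, so the description extends along
it until a leaf is reached. -/
theorem search_sound [Finite Q] {Rs : List (RegularExpression (Fin 2))}
    {guide : List (List (Fin 2))} (hR : ∀ R ∈ Rs, ∃ u ∈ R.matches', (missing δ u).ncard ≤ 2) :
    ∀ {f : ℕ} {P : PartialAutomaton} {ι : ℕ → Q} {items : List (List ℕ × List (Fin 2))},
      search Rs guide f P items = true → P.Models ι δ → (∀ s ∈ items, Pending ι P.size δ s) →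
        ∀ w, (missing δ w).ncard ≤ 2
  | 0, _, _, _, h, _, _ => by simp [search] at h
  | f + 1, P, ι, items, h, hP, hs => by
    obtain ⟨items', hi, hi'⟩ := advanceAll_sound hP hs
    rw [search, hi] at h
    simp only [Bool.or_eq_true, Bool.and_eq_true] at h
    rcases h with (h | ⟨-, h⟩) | ⟨⟨⟨hr, hhead⟩, hnone⟩, h⟩
    · exact ncard_le_two_of_isClosed hP h
    · obtain ⟨R, hRs, h⟩ := List.any_eq_true.1 h
      obtain ⟨u, hu, hu'⟩ := hR R hRs
      have := three_le_of_post_isEmpty hP h hu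
      omega
    · generalize P.needed (bif items'.isEmpty then P.pending guide else items') = xr
        at h hr hhead hnone
      obtain ⟨x, r⟩ := xr
      simp only [Nat.blt_eq, List.all_eq_true, List.mem_range, Bool.or_eq_true, elem_iff,
        List.any_eq_true, Nat.beq_eq, Option.isNone_iff_eq_none] at h hr hhead hnone
      by_cases hj : ∃ j < P.size, ι j = δ (ι r) x
      · obtain ⟨j, hj, e⟩ := hj
        rcases h j (Nat.lt_succ_of_lt hj) with (hg | ⟨t, ht, ht'⟩) | h
        · exact absurd e.symm (((hP x).mem_gap _).2 ⟨j, hg, rfl⟩ _)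
        -- Two heads with the same value coincide, so the chosen transition would already be
        -- recorded.
        · refine absurd ?_ (ne_of_value_none hnone ht)
          exact (hP x).eq_of_isHead ((hP x).tr_lt t ht).1 hr ((hP x).tr_head t ht) hhead
            (((hP x).tr_eq t ht).trans (by rw [ht', e]))
        · refine search_sound hR h (assign_models_of_lt hP hr hj hhead e.symm) fun s hs => ?_
          obtain ⟨p, hK, hp⟩ := hi' s hs
          have hsize : (P.assign x r j).size = P.size := by
            have hb : Nat.beq j P.size = false := Bool.eq_false_iff.2 (by simpa using hj.ne)
            fin_cases x <;> simp [assign, hb]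
          exact ⟨p, hsize ▸ hK, hp⟩
      · push Not at hj
        rcases h P.size (Nat.lt_succ_self _) with (hg | ⟨t, ht, ht'⟩) | h
        · exact absurd ((hP x).gap_lt _ hg) (lt_irrefl _)
        · exact absurd ((hP x).tr_lt t ht).2 (by rw [ht']; exact lt_irrefl _)
        · refine search_sound hR h (assign_models_of_new hP hr hhead hj) fun s hs => ?_
          obtain ⟨p, hK, hp⟩ := hi' s hs
          have hsize : (P.assign x r P.size).size = P.size + 1 := by
            fin_cases x <;> simp [assign]
          refine ⟨p, ⟨hK.nodup, fun i hi => ?_, fun i hi => ?_⟩, hp⟩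
          · rw [hsize]
            exact Nat.lt_succ_of_lt (hK.lt i hi)
          · rw [Function.update_of_ne (hK.lt i hi).ne]
            exact hK.mem i hi

end PartialAutomaton
end CollapsingWords

/-! ### Relative positions of the two letters -/

namespace CollapsingWords

open PartialMap

variable {Q : Type}

namespace PartialMap

/-- Rename the states of a partial map without known values along a list of names. -/
def rename (l : PartialMap) (e : List ℕ) : PartialMap :=
  ⟨l.gap.map (e.getD · 0), l.ker.map fun C => C.map (e.getD · 0), []⟩

theorem Models.rename {κ ι : ℕ → Q} {k n : ℕ} {l : PartialMap} {f : Q → Q} (h : l.Models κ k f)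
    {e : List ℕ} (inj : ∀ i < n, ∀ j < n, ι i = ι j → i = j)
    (he : ∀ i < k, e.getD i 0 < n ∧ ι (e.getD i 0) = κ i) : (l.rename e).Models ι n f := by
  have hinj : ∀ i < k, ∀ j < k, e.getD i 0 = e.getD j 0 → i = j := fun i hi j hj hij =>
    h.inj i hi j hj (by rw [← (he i hi).2, ← (he j hj).2, hij])
  have key : ∀ C : List ℕ, (∀ i ∈ C, i < k) → ∀ q,
      (∃ i ∈ C.map (e.getD · 0), ι i = q) ↔ ∃ i ∈ C, κ i = q := by
    intro C hC q
    simp only [List.mem_map, exists_exists_and_eq_and]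
    exact exists_congr fun i => and_congr_right fun hi => by rw [(he i (hC i hi)).2]
  exact
  { inj := inj
    gap_lt := by
      intro i hi
      obtain ⟨j, hj, rfl⟩ := List.mem_map.1 hi
      exact (he j (h.gap_lt j hj)).1
    gap_nodup := h.gap_nodup.map_on fun i hi j hj =>
      hinj i (h.gap_lt i hi) j (h.gap_lt j hj)
    mem_gap := fun q => (h.mem_gap q).trans (key _ h.gap_lt q).symm
    ker_lt := by
      intro C hC i hi
      obtain ⟨C, hC', rfl⟩ := List.mem_map.1 hC
      obtain ⟨j, hj, rfl⟩ := List.mem_map.1 hi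
      exact (he j (h.ker_lt C hC' j hj)).1
    ker_disjoint := by
      intro C hC D hD i hi hi'
      obtain ⟨C, hC', rfl⟩ := List.mem_map.1 hC
      obtain ⟨D, hD', rfl⟩ := List.mem_map.1 hD
      obtain ⟨j, hj, rfl⟩ := List.mem_map.1 hi
      obtain ⟨j', hj', e⟩ := List.mem_map.1 hi'
      have := hinj j' (h.ker_lt D hD' j' hj') j (h.ker_lt C hC' j hj) e
      subst this
      rw [h.ker_disjoint C hC' D hD' j' hj hj']
    fiber := by
      intro p q
      rw [h.fiber]
      refine or_congr_right ?_
      simp only [PartialMap.rename, List.mem_map (f := fun C : List ℕ => C.map (e.getD · 0)),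
        exists_exists_and_eq_and]
      exact exists_congr fun C => and_congr_right fun hC => by
        rw [key C (h.ker_lt C hC), key C (h.ker_lt C hC)]
    tr_lt := by simp [PartialMap.rename]
    tr_head := by simp [PartialMap.rename]
    tr_eq := by simp [PartialMap.rename] }

end PartialMap

/-- The ways to name `k` distinct states when `n` states have names: the list of their names and the
number of names in use afterwards. -/
def placements : ℕ → ℕ → List (List ℕ × ℕ)
  | 0, n => [([], n)]
  | k + 1, n => (placements k n).flatMap fun e =>
      (List.range (e.2 + 1)).filterMap fun j =>
        bif elem j e.1 then none
        else some (j :: e.1, bif Nat.beq j e.2 then e.2 + 1 else e.2)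

/-- Each further state either has a name already, which cannot be one used for the other listed
states, or takes the next free name. -/
theorem exists_placement {ι : ℕ → Q} {n : ℕ} (inj : ∀ i < n, ∀ j < n, ι i = ι j → i = j) :
    ∀ {qs : List Q}, qs.Nodup → ∃ e ∈ placements qs.length n, ∃ κ : ℕ → Q,
      (∀ i < e.2, ∀ j < e.2, κ i = κ j → i = j) ∧ n ≤ e.2 ∧ (∀ i < n, κ i = ι i) ∧
        (∀ i ∈ e.1, i < e.2) ∧ e.1.map κ = qs
  | [], _ => ⟨([], n), by simp [placements], ι, inj, le_rfl, fun _ _ => rfl, by simp, rfl⟩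
  | q :: qs, hq => by
    obtain ⟨hq, hqs⟩ := List.nodup_cons.1 hq
    obtain ⟨e, he, κ, hκ, hn, hext, hlt, hmap⟩ := exists_placement inj hqs
    by_cases hj : ∃ j < e.2, κ j = q
    · obtain ⟨j, hj, rfl⟩ := hj
      have hje : elem j e.1 = false := by
        rw [Bool.eq_false_iff, ne_eq, elem_iff]
        exact fun h => hq (hmap ▸ List.mem_map_of_mem h)
      have hb : Nat.beq j e.2 = false := Bool.eq_false_iff.2 (by simpa using hj.ne)
      refine ⟨(j :: e.1, e.2), ?_, κ, hκ, hn, hext, ?_, by simp [hmap]⟩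
      · refine List.mem_flatMap.2 ⟨e, he, List.mem_filterMap.2 ⟨j, ?_, by simp [hje, hb]⟩⟩
        exact List.mem_range.2 (Nat.lt_succ_of_lt hj)
      · simpa [hj] using hlt
    · push Not at hj
      have hje : elem e.2 e.1 = false := by
        rw [Bool.eq_false_iff, ne_eq, elem_iff]
        exact fun h => lt_irrefl _ (hlt _ h)
      refine ⟨(e.2 :: e.1, e.2 + 1), ?_, Function.update κ e.2 q, update_injOn hκ hj,
        hn.trans (Nat.le_succ _), fun i hi => ?_, ?_, ?_⟩
      · exact List.mem_flatMap.2 ⟨e, he, List.mem_filterMap.2 ⟨e.2, by simp, by simp [hje]⟩⟩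
      · rw [Function.update_of_ne (hi.trans_le hn).ne, hext i hi]
      · intro i hi
        rcases List.mem_cons.1 hi with rfl | hi
        exacts [Nat.lt_succ_self _, Nat.lt_succ_of_lt (hlt i hi)]
      · rw [List.map_cons, Function.update_self, ← hmap]
        congr 1
        exact List.map_congr_left fun i hi => Function.update_of_ne (hlt i hi).ne _ _

/-- The fibres and the complement of the range of a map, up to naming. -/
structure Shape where
  arity : ℕ
  gap : List ℕ
  ker : List (List ℕ)

/-- The shape as a partial map without known values. -/
def Shape.toPartialMap (s : Shape) : PartialMap :=
  ⟨s.gap, s.ker, []⟩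

/-- The map `f` has the shape `s`. -/
def Shape.Fits (s : Shape) (f : Q → Q) : Prop :=
  ∃ κ : ℕ → Q, s.toPartialMap.Models κ s.arity f

/-- The symbolic search for all relative positions of letters of the given shapes. -/
def verify (Rs : List (RegularExpression (Fin 2))) (guide : List (List (Fin 2))) (s t : Shape)
    (ws : List (List (Fin 2))) : Bool :=
  (placements t.arity s.arity).all fun e =>
    PartialAutomaton.search Rs guide 30
      ⟨e.2, s.toPartialMap, t.toPartialMap.rename e.1⟩ (ws.map ([], ·))

theorem verify_sound [Finite Q] {δ : Q → Fin 2 → Q} {Rs : List (RegularExpression (Fin 2))}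
    {guide : List (List (Fin 2))} {s t : Shape} {ws : List (List (Fin 2))}
    (h : verify Rs guide s t ws = true) (hs : s.Fits (δ · a)) (ht : t.Fits (δ · b))
    (hR : ∀ R ∈ Rs, ∃ u ∈ R.matches', (missing δ u).ncard ≤ 2)
    (hw : ∀ w ∈ ws, (missing δ w).ncard ≤ 2) (w : List (Fin 2)) : (missing δ w).ncard ≤ 2 := by
  obtain ⟨ι, hι⟩ := hs
  obtain ⟨κ, hκ⟩ := ht
  have hnd : ((List.range t.arity).map κ).Nodup := List.nodup_range.map_on fun i hi j hj =>
    hκ.inj i (List.mem_range.1 hi) j (List.mem_range.1 hj)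
  obtain ⟨e, he, μ, hμ, hn, hext, hlt, hmap⟩ := exists_placement hι.inj hnd
  rw [List.length_map, List.length_range] at he
  have hlen : e.1.length = t.arity := by
    simpa using congrArg List.length hmap
  refine PartialAutomaton.search_sound hR (ι := μ) (List.all_eq_true.1 h e he) ?_ ?_ w
  · intro x
    fin_cases x
    · exact hι.extend hn hext hμ
    · refine hκ.rename hμ fun i hi => ?_
      have hi' : i < e.1.length := hlen ▸ hi
      rw [List.getD_eq_getElem _ _ hi']
      refine ⟨hlt _ (List.getElem_mem hi'), ?_⟩
      have := List.getElem_of_eq hmap (i := i) (by simpa using hi')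
      simpa using this
  · intro s hs
    obtain ⟨w, hw', rfl⟩ := List.mem_map.1 hs
    exact ⟨[], .nil _ _ _, hw w hw'⟩

end CollapsingWords

/-! ### Classification of the letters by shape -/

namespace CollapsingWords

open PartialMap

variable {Q : Type}

/-- A bijective map. -/
def bijectiveShape : Shape := ⟨0, [], []⟩

/-- A fibre of three states, two of which are missing. -/
def tripleShape : Shape := ⟨3, [0, 1], [[0, 1, 2]]⟩

/-- Two fibres of two states with one state missing from each. -/
def twoPairsShape : Shape := ⟨4, [0, 2], [[0, 1], [2, 3]]⟩

/-- A fibre of two states, one of which is missing. -/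
def innerPairShape : Shape := ⟨2, [0], [[0, 1]]⟩

/-- A fibre of two states and a missing state outside of it. -/
def outerPairShape : Shape := ⟨3, [2], [[0, 1]]⟩

section Fits

variable {f : Q → Q}

theorem fits_bijectiveShape [Nonempty Q] (hf : Function.Bijective f) : bijectiveShape.Fits f := by
  refine ⟨fun _ => Classical.arbitrary Q, ?_⟩
  constructor <;> simp [bijectiveShape, Shape.toPartialMap, hf.1.eq_iff]
  intro q
  exact hf.2 q

theorem fits_innerPairShape {p q : Q} (hpq : p ≠ q)
    (hf : ∀ u v, f u = f v ↔ u = v ∨ (u = p ∨ u = q) ∧ (v = p ∨ v = q))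
    (hgap : ∀ z, (∀ y, f y ≠ z) ↔ z = p) : innerPairShape.Fits f := by
  -- The default `p` names only indices beyond the arity, about which nothing is required.
  refine ⟨([p, q].getD · p), ?_⟩
  constructor
  case inj =>
    intro i hi j hj
    simp only [innerPairShape] at hi hj
    interval_cases i <;> interval_cases j <;> simp [hpq, hpq.symm]
  case fiber =>
    intro u v
    rw [hf]
    simp [innerPairShape, Shape.toPartialMap, eq_comm]
  case mem_gap =>
    intro z
    rw [hgap]
    simp [innerPairShape, Shape.toPartialMap, eq_comm]
  all_goals simp [innerPairShape, Shape.toPartialMap]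

theorem fits_outerPairShape {p q r : Q} (hpq : p ≠ q) (hpr : p ≠ r) (hqr : q ≠ r)
    (hf : ∀ u v, f u = f v ↔ u = v ∨ (u = p ∨ u = q) ∧ (v = p ∨ v = q))
    (hgap : ∀ z, (∀ y, f y ≠ z) ↔ z = r) : outerPairShape.Fits f := by
  refine ⟨([p, q, r].getD · p), ?_⟩
  constructor
  case inj =>
    intro i hi j hj
    simp only [outerPairShape] at hi hj
    interval_cases i <;> interval_cases j <;> simp [hpq, hpq.symm, hpr, hpr.symm, hqr, hqr.symm]
  case fiber =>
    intro u v
    rw [hf]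
    simp [outerPairShape, Shape.toPartialMap, eq_comm]
  case mem_gap =>
    intro z
    rw [hgap]
    simp [outerPairShape, Shape.toPartialMap, eq_comm]
  all_goals simp [outerPairShape, Shape.toPartialMap]

theorem fits_tripleShape {p q r : Q} (hpq : p ≠ q) (hpr : p ≠ r) (hqr : q ≠ r)
    (hf : ∀ u v, f u = f v ↔ u = v ∨ (u = p ∨ u = q ∨ u = r) ∧ (v = p ∨ v = q ∨ v = r))
    (hgap : ∀ z, (∀ y, f y ≠ z) ↔ z = p ∨ z = q) : tripleShape.Fits f := by
  refine ⟨([p, q, r].getD · p), ?_⟩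
  constructor
  case inj =>
    intro i hi j hj
    simp only [tripleShape] at hi hj
    interval_cases i <;> interval_cases j <;> simp [hpq, hpq.symm, hpr, hpr.symm, hqr, hqr.symm]
  case fiber =>
    intro u v
    rw [hf]
    simp [tripleShape, Shape.toPartialMap, eq_comm]
  case mem_gap =>
    intro z
    rw [hgap]
    simp [tripleShape, Shape.toPartialMap, eq_comm]
  all_goals simp [tripleShape, Shape.toPartialMap]

theorem fits_twoPairsShape {p q r s : Q} (hnd : [p, q, r, s].Nodup)
    (hf : ∀ u v, f u = f v ↔ u = v ∨ (u = p ∨ u = q) ∧ (v = p ∨ v = q) ∨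
      (u = r ∨ u = s) ∧ (v = r ∨ v = s))
    (hgap : ∀ z, (∀ y, f y ≠ z) ↔ z = p ∨ z = r) : twoPairsShape.Fits f := by
  refine ⟨([p, q, r, s].getD · p), ?_⟩
  constructor
  case inj =>
    intro i hi j hj e
    have hi' : i < [p, q, r, s].length := hi
    have hj' : j < [p, q, r, s].length := hj
    rw [List.getD_eq_getElem _ _ hi', List.getD_eq_getElem _ _ hj'] at e
    exact hnd.getElem_inj_iff.1 e
  case fiber =>
    intro u v
    rw [hf]
    simp [twoPairsShape, Shape.toPartialMap, eq_comm]
  case mem_gap =>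
    intro z
    rw [hgap]
    simp [twoPairsShape, Shape.toPartialMap, eq_comm]
  all_goals simp [twoPairsShape, Shape.toPartialMap]

end Fits

theorem ncard_range_add [Finite Q] (f : Q → Q) :
    (Set.range f).ncard + (Set.range f)ᶜ.ncard = Nat.card Q :=
  Set.ncard_add_ncard_compl _

/-- The states of `T` are redundant for the range, so `f` maps the complement of `T` onto its range.
The two sets have equal cardinality, and the map between them is injective. -/
theorem injOn_compl_of_ncard [Finite Q] {f : Q → Q} {T : Set Q}
    (hT : ∀ t ∈ T, ∃ q ∉ T, f q = f t) (hc : T.ncard = (Set.range f)ᶜ.ncard) :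
    Set.InjOn f Tᶜ := by
  have himg : f '' Tᶜ = Set.range f := by
    refine (Set.image_subset_range _ _).antisymm ?_
    rintro _ ⟨q, rfl⟩
    by_cases hq : q ∈ T
    · obtain ⟨p, hp, e⟩ := hT q hq
      exact ⟨p, hp, e⟩
    · exact ⟨q, hq, rfl⟩
  refine Set.injOn_of_ncard_image_eq ?_ (Set.toFinite _)
  have h1 := ncard_range_add f
  have h2 := Set.ncard_add_ncard_compl T
  rw [himg]
  omega

/-- One missing state leaves room for a single collision, hence for exactly one nontrivial fibre, a
pair. The two shapes record whether the missing state belongs to it. -/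
theorem fits_of_ncard_one [Finite Q] {f : Q → Q} (h1 : (Set.range f)ᶜ.ncard = 1) :
    innerPairShape.Fits f ∨ outerPairShape.Fits f := by
  obtain ⟨r, hr⟩ := Set.ncard_eq_one.1 h1
  have hgap : ∀ z, (∀ y, f y ≠ z) ↔ z = r := fun z => by
    have := Set.ext_iff.1 hr z
    simpa using this
  have hninj : ¬ Function.Injective f := fun h => by
    obtain ⟨y, hy⟩ := Finite.surjective_of_injective h r
    exact (hgap r).2 rfl y hy
  obtain ⟨p, q, hpq, hne⟩ : ∃ p q, f p = f q ∧ p ≠ q := by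
    simpa [Function.Injective] using hninj
  have hinj : Set.InjOn f {p}ᶜ := injOn_compl_of_ncard
    (by simpa using ⟨q, hne.symm, hpq.symm⟩) (by simp [h1])
  have hf : ∀ u v, f u = f v ↔ u = v ∨ (u = p ∨ u = q) ∧ (v = p ∨ v = q) := by
    have hp : ∀ v, f v = f p → v = p ∨ v = q := fun v hv => by
      by_cases hvp : v = p
      · exact .inl hvp
      · exact .inr (hinj hvp hne.symm (hv.trans hpq))
    intro u v
    constructor
    · intro e
      by_cases hu : u = p
      · subst hu
        exact .inr ⟨.inl rfl, hp v e.symm⟩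
      by_cases hv : v = p
      · subst hv
        exact .inr ⟨hp u e, .inl rfl⟩
      exact .inl (hinj hu hv e)
    · rintro (rfl | ⟨rfl | rfl, rfl | rfl⟩) <;> simp [hpq]
  by_cases hrp : r = p
  · subst hrp
    exact .inl (fits_innerPairShape hne hf hgap)
  by_cases hrq : r = q
  · subst hrq
    exact .inl (fits_innerPairShape (Ne.symm hne) (fun u v => by rw [hf]; tauto) hgap)
  exact .inr (fits_outerPairShape hne (Ne.symm hrp) (Ne.symm hrq) hf hgap)

/-- The kernel of a map that misses exactly two states. -/
theorem exists_fibers_of_ncard_two [Finite Q] {f : Q → Q} (h2 : (Set.range f)ᶜ.ncard = 2) :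
    ∃ p q t u, p ≠ q ∧ t ≠ u ∧ p ≠ t ∧ q ≠ t ∧ p ≠ u ∧
      f p = f q ∧ f t = f u ∧ Set.InjOn f {p, t}ᶜ := by
  have hninj : ¬ Function.Injective f := fun h => by
    rw [(Finite.surjective_of_injective h).range_eq] at h2
    simp at h2
  obtain ⟨p, q, hpq, hne⟩ : ∃ p q, f p = f q ∧ p ≠ q := by
    simpa [Function.Injective] using hninj
  -- If `f` were injective away from `p`, its range would omit at most one state.
  have hninj' : ¬ Set.InjOn f {p}ᶜ := fun h => by
    have e1 := h.ncard_image
    have e2 := Set.ncard_add_ncard_compl {p}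
    have e3 := ncard_range_add f
    have e4 := Set.ncard_le_ncard (Set.image_subset_range f {p}ᶜ) (Set.toFinite _)
    rw [Set.ncard_singleton] at e2
    omega
  obtain ⟨t, u, htp, hup, htq, htu, hne'⟩ : ∃ t u, t ≠ p ∧ u ≠ p ∧ t ≠ q ∧ f t = f u ∧ t ≠ u := by
    simp only [Set.InjOn, not_forall] at hninj'
    obtain ⟨t, ht, u, hu, e, hne'⟩ := hninj'
    -- Exchanging the two colliding states if necessary ensures that the first differs from `q`.
    by_cases htq : t = q
    · exact ⟨u, t, hu, ht, fun h => hne' (htq.trans h.symm), e.symm, Ne.symm hne'⟩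
    · exact ⟨t, u, ht, hu, htq, e, hne'⟩
  refine ⟨p, q, t, u, hne, hne', Ne.symm htp, Ne.symm htq, Ne.symm hup, hpq, htu, ?_⟩
  refine injOn_compl_of_ncard ?_ (by rw [Set.ncard_pair (Ne.symm htp), h2])
  rintro z (rfl | rfl)
  · exact ⟨q, by simp [Ne.symm hne, Ne.symm htq], hpq.symm⟩
  · exact ⟨u, by simp [Ne.symm hne', hup], htu.symm⟩

theorem fiber_iff_of_triple {f : Q → Q} {p q t : Q} (hpq : p ≠ q) (hqt : q ≠ t)
    (epq : f p = f q) (etq : f t = f q)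
    (hinj : ∀ x y, x ≠ p → x ≠ t → y ≠ p → y ≠ t → f x = f y → x = y) (x y : Q) :
    f x = f y ↔ x = y ∨ (x = p ∨ x = q ∨ x = t) ∧ (y = p ∨ y = q ∨ y = t) := by
  have key : ∀ z, f z = f q → z = p ∨ z = q ∨ z = t := fun z hz => by
    by_cases h1 : z = p
    · exact .inl h1
    by_cases h2 : z = t
    · exact .inr (.inr h2)
    exact .inr (.inl (hinj z q h1 h2 hpq.symm hqt hz))
  constructor
  · intro e
    by_cases hx : f x = f q
    · exact .inr ⟨key x hx, key y (e ▸ hx)⟩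
    · refine .inl (hinj x y ?_ ?_ ?_ ?_ e) <;> rintro rfl
      exacts [hx epq, hx etq, hx (e.trans epq), hx (e.trans etq)]
  · rintro (rfl | ⟨rfl | rfl | rfl, rfl | rfl | rfl⟩) <;> simp [epq, etq]

theorem fiber_iff_of_pairs {f : Q → Q} {p q t u : Q} (hpq : p ≠ q) (htu : t ≠ u)
    (hqt : q ≠ t) (hpu : p ≠ u) (epq : f p = f q) (etu : f t = f u)
    (hinj : ∀ x y, x ≠ p → x ≠ t → y ≠ p → y ≠ t → f x = f y → x = y) (hqu : q ≠ u) (x y : Q) :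
    f x = f y ↔ x = y ∨ (x = p ∨ x = q) ∧ (y = p ∨ y = q) ∨
      (x = t ∨ x = u) ∧ (y = t ∨ y = u) := by
  have hne : f q ≠ f u := fun e => hqu (hinj q u hpq.symm hqt hpu.symm htu.symm e)
  have key : ∀ z, f z = f q → z = p ∨ z = q := fun z hz => by
    by_cases h1 : z = p
    · exact .inl h1
    refine .inr (hinj z q h1 ?_ hpq.symm hqt hz)
    rintro rfl
    exact hne (hz.symm.trans etu)
  have key' : ∀ z, f z = f u → z = t ∨ z = u := fun z hz => by
    by_cases h1 : z = t
    · exact .inl h1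
    refine .inr (hinj z u ?_ h1 hpu.symm htu.symm hz)
    rintro rfl
    exact hne (epq.symm.trans hz)
  constructor
  · intro e
    by_cases hx : f x = f q
    · exact .inr (.inl ⟨key x hx, key y (e ▸ hx)⟩)
    by_cases hx' : f x = f u
    · exact .inr (.inr ⟨key' x hx', key' y (e ▸ hx')⟩)
    refine .inl (hinj x y ?_ ?_ ?_ ?_ e) <;> rintro rfl
    exacts [hx epq, hx' etu, hx (e.trans epq), hx' (e.trans etu)]
  · rintro (rfl | ⟨rfl | rfl, rfl | rfl⟩ | ⟨rfl | rfl, rfl | rfl⟩) <;> simp [epq, etu]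

theorem exists_third {p q t r s : Q} (hpq : p ≠ q) (hpt : p ≠ t) (hqt : q ≠ t) (hrs : r ≠ s)
    (hr : r = p ∨ r = q ∨ r = t) (hs : s = p ∨ s = q ∨ s = t) :
    ∃ z, r ≠ z ∧ s ≠ z ∧ ∀ x, (x = p ∨ x = q ∨ x = t) ↔ (x = r ∨ x = s ∨ x = z) := by
  rcases hr with rfl | rfl | rfl <;> rcases hs with rfl | rfl | rfl
  · exact absurd rfl hrs
  · exact ⟨t, hpt, hqt, fun x => Iff.rfl⟩
  · exact ⟨q, hpq, hqt.symm, fun x => by tauto⟩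
  · exact ⟨t, hqt, hpt, fun x => by tauto⟩
  · exact absurd rfl hrs
  · exact ⟨p, hpq.symm, hpt.symm, fun x => by tauto⟩
  · exact ⟨q, hqt.symm, hpq, fun x => by tauto⟩
  · exact ⟨p, hpt.symm, hpq.symm, fun x => by tauto⟩
  · exact absurd rfl hrs

/-- A pair of two distinct elements is determined by these elements. -/
theorem pair_iff_of_mem {p q r r' : Q} (hne : r' ≠ r) (hr' : r' = p ∨ r' = q)
    (hr : r = p ∨ r = q) (x : Q) : (x = p ∨ x = q) ↔ (x = r ∨ x = r') := by
  rcases hr with rfl | rfl <;> rcases hr' with rfl | rfl <;> tauto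

/-- If `r` and `s` lay in the same pair, that pair would already consist of `r` and its mate `r'`,
leaving no place for `s`. So each pair contains exactly one of `r` and `s`. -/
theorem pairs_iff_of_mates {p q t u r r' s s' : Q} (hrs : r ≠ s) (hr : r' ≠ r) (hrs' : r' ≠ s)
    (hs : s' ≠ s) (hsr' : s' ≠ r)
    (hpt : p ≠ t) (hqt : q ≠ t) (hpu : p ≠ u) (hqu : q ≠ u)
    (er : r' = r ∨ (r' = p ∨ r' = q) ∧ (r = p ∨ r = q) ∨ (r' = t ∨ r' = u) ∧ (r = t ∨ r = u))
    (es : s' = s ∨ (s' = p ∨ s' = q) ∧ (s = p ∨ s = q) ∨ (s' = t ∨ s' = u) ∧ (s = t ∨ s = u)) :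
    [r, r', s, s'].Nodup ∧ ∀ x y,
      ((x = p ∨ x = q) ∧ (y = p ∨ y = q) ∨ (x = t ∨ x = u) ∧ (y = t ∨ y = u)) ↔
        ((x = r ∨ x = r') ∧ (y = r ∨ y = r') ∨ (x = s ∨ x = s') ∧ (y = s ∨ y = s')) := by
  have hdisj : ∀ x, (x = p ∨ x = q) → ¬ (x = t ∨ x = u) := by
    rintro x (rfl | rfl) (h | h)
    exacts [hpt h, hpu h, hqt h, hqu h]
  rcases er.resolve_left hr with ⟨h1, h2⟩ | ⟨h1, h2⟩ <;>
    rcases es.resolve_left hs with ⟨h3, h4⟩ | ⟨h3, h4⟩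
  · have := (pair_iff_of_mem hr h1 h2 s).1 h4
    exact absurd this (not_or.2 ⟨hrs.symm, hrs'.symm⟩)
  · refine ⟨?_, fun x y => ?_⟩
    · have h5 : r' ≠ s' := fun h => hdisj r' h1 (h ▸ h3)
      simp [hr.symm, hrs, hsr'.symm, hrs', h5, hs.symm]
    · simp only [pair_iff_of_mem hr h1 h2, pair_iff_of_mem hs h3 h4]
  · refine ⟨?_, fun x y => ?_⟩
    · have h5 : r' ≠ s' := fun h => hdisj s' h3 (h ▸ h1)
      simp [hr.symm, hrs, hsr'.symm, hrs', h5, hs.symm]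
    · simp only [pair_iff_of_mem hr h1 h2, pair_iff_of_mem hs h3 h4]
      exact or_comm
  · have := (pair_iff_of_mem hr h1 h2 s).1 h4
    exact absurd this (not_or.2 ⟨hrs.symm, hrs'.symm⟩)

/-- A fibre inside the missing set would add a third missing state to the two gap states, which stay
missing. So each missing state shares its fibre with a state of the range, and the fibres are one
triple containing both missing states or two pairs containing one each. -/
theorem fits_of_ncard_two [Finite Q] {f : Q → Q} (h2 : (Set.range f)ᶜ.ncard = 2)
    (hn : (next f (Set.range f)ᶜ).ncard ≤ 2) : tripleShape.Fits f ∨ twoPairsShape.Fits f := by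
  have hout : ∀ y, ∃ y', f y' = f y ∧ y' ∈ Set.range f := by
    by_contra! hy
    obtain ⟨y, hy⟩ := hy
    have hsub : insert (f y) (Set.range f)ᶜ ⊆ next f (Set.range f)ᶜ := by
      rintro z (rfl | hz) p hp
      · exact hy p hp
      · exact absurd ⟨p, hp⟩ hz
    have := Set.ncard_le_ncard hsub (Set.toFinite _)
    rw [Set.ncard_insert_of_notMem (by simp), h2] at this
    omega
  obtain ⟨r, s, hrs, hD⟩ := Set.ncard_eq_two.1 h2
  have hgap : ∀ z, (∀ y, f y ≠ z) ↔ z = r ∨ z = s := fun z => by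
    have := Set.ext_iff.1 hD z
    simpa using this
  have hmate : ∀ z, z = r ∨ z = s → ∃ z', f z' = f z ∧ z' ≠ r ∧ z' ≠ s := fun z _ => by
    obtain ⟨z', e, y, hy⟩ := hout z
    have := mt (hgap z').2 (fun h => h y hy)
    exact ⟨z', e, not_or.1 this⟩
  obtain ⟨p, q, t, u, hpq, htu, hpt, hqt, hpu, epq, etu, hinj⟩ := exists_fibers_of_ncard_two h2
  have hinj' : ∀ x y, x ≠ p → x ≠ t → y ≠ p → y ≠ t → f x = f y → x = y :=
    fun x y h1 h2 h3 h4 e => hinj (by simp [h1, h2]) (by simp [h3, h4]) e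
  obtain ⟨r', er, hr1, hr2⟩ := hmate r (.inl rfl)
  obtain ⟨s', es, hs1, hs2⟩ := hmate s (.inr rfl)
  by_cases hqu : q = u
  · subst hqu
    have hf := fiber_iff_of_triple hpq hqt epq etu hinj'
    obtain ⟨z, hrz, hsz, hz⟩ := exists_third hpq hpt hqt hrs
      (((hf _ _).1 er).resolve_left hr1).2 (((hf _ _).1 es).resolve_left hs2).2
    exact .inl (fits_tripleShape hrs hrz hsz (fun x y => by rw [hf, hz, hz]) hgap)
  · have hf := fiber_iff_of_pairs hpq htu hqt hpu epq etu hinj' hqu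
    obtain ⟨hnd, hyz⟩ := pairs_iff_of_mates hrs hr1 hr2 hs2 hs1 hpt hqt hpu hqu
      ((hf _ _).1 er) ((hf _ _).1 es)
    exact .inr (fits_twoPairsShape hnd (fun x y => by rw [hf, hyz]) hgap)

/-- The shapes of the letters whose square has deficiency at most two. -/
theorem exists_shape [Finite Q] [Nonempty Q] {δ : Q → Fin 2 → Q} {x : Fin 2}
    (h : (missing δ [x, x]).ncard ≤ 2) :
    bijectiveShape.Fits (δ · x) ∨ tripleShape.Fits (δ · x) ∨ twoPairsShape.Fits (δ · x) ∨
      innerPairShape.Fits (δ · x) ∨ outerPairShape.Fits (δ · x) := by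
  have hx : missing δ [x] = (Set.range (δ · x))ᶜ := rfl
  have hxx : missing δ [x, x] = next (δ · x) (Set.range (δ · x))ᶜ := by
    rw [← hx, ← missing_concat]
    rfl
  have hle : (Set.range (δ · x))ᶜ.ncard ≤ 2 := by
    have := deficiency_le_append_right δ [x] [x]
    rw [deficiency_eq, deficiency_eq] at this
    exact this.trans h
  rw [hxx] at h
  rcases Nat.lt_or_eq_of_le hle with h2 | h2
  · rcases Nat.lt_or_eq_of_le (Nat.le_of_lt_succ h2) with h1 | h1
    · have h0 : (Set.range (δ · x))ᶜ = ∅ := by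
        rw [← Set.ncard_eq_zero (Set.toFinite _)]
        omega
      have hsurj : Function.Surjective (δ · x) :=
        Set.range_eq_univ.1 (Set.compl_empty_iff.1 h0)
      exact .inl (fits_bijectiveShape ⟨Finite.injective_iff_surjective.2 hsurj, hsurj⟩)
    · have := fits_of_ncard_one h1
      tauto
  · have := fits_of_ncard_two h2 h
    tauto

end CollapsingWords

/-! ### Regular expressions, duality and the fifteen pairs of shapes -/

namespace CollapsingWords

open RegularExpression

variable {Q : Type}

/-- A regular expression for the language `L`. -/
def regexL : RegularExpression (Fin 2) :=
  char b * star (char a * star (char a) * char b) *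
    (char b * char a * star (char b * char a)) * char a * star (char b * char a) *
    (char a * char b) * (char b + char a * (char b * char b))

/-- A regular expression for the language `dualL`. -/
def regexDualL : RegularExpression (Fin 2) :=
  regexL.map (Equiv.swap a b)

theorem singleton_mul_singleton (x y : List (Fin 2)) :
    ({x} : Language (Fin 2)) * {y} = {x ++ y} :=
  Set.image2_singleton

theorem matches_regexL : regexL.matches' = L := by
  simp only [regexL, L, matches'_mul, matches'_add, matches'_star, matches'_char,
    singleton_mul_singleton, List.singleton_append]

theorem dual_dual (w : List (Fin 2)) : dual (dual w) = w := by
  simp [dual, Function.comp_def]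

theorem mem_dualL_iff {w : List (Fin 2)} : w ∈ dualL ↔ dual w ∈ L := Iff.rfl

theorem mem_matches_regexDualL {w : List (Fin 2)} (h : w ∈ dualL) : w ∈ regexDualL.matches' := by
  rw [regexDualL, matches'_map, matches_regexL]
  exact ⟨dual w, h, dual_dual w⟩

/-- Words that visit the transitions relevant for `L` and `dualL`. -/
def guideWords : List (List (Fin 2)) :=
  [[b, a, b, b, a, a, a, b, a, b, b], [b, a, b, b, a, b, a, a, b, a, a, b, b],
    [a, b, a, a, b, b, b, a, b, a, a], [a, b, a, a, b, a, b, b, a, b, b, a, a]]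

/-- The automaton has deficiency at most two on all words of length three, on `W'`, and on a member
of `L` and of `dualL`. -/
structure SmallOnTests (δ : Q → Fin 2 → Q) : Prop where
  full : ∀ x : List (Fin 2), x.length = 3 → deficiency δ x ≤ 2
  mem_W' : ∀ x ∈ W', deficiency δ x ≤ 2
  mem_L : ∃ u ∈ L, deficiency δ u ≤ 2
  mem_dualL : ∃ v ∈ dualL, deficiency δ v ≤ 2

theorem act_swap (δ : Q → Fin 2 → Q) (w : List (Fin 2)) :
    act (fun q x => δ q (Equiv.swap a b x)) w = act δ (dual w) := by
  ext q
  simp [act, dual, List.foldl_map]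

theorem deficiency_swap (δ : Q → Fin 2 → Q) (w : List (Fin 2)) :
    deficiency (fun q x => δ q (Equiv.swap a b x)) w = deficiency δ (dual w) := by
  rw [deficiency, deficiency, act_swap]

theorem dual_mem_W' : ∀ x ∈ W', dual x ∈ W' := by
  decide

/-- The tests are self-dual as a whole: `W'` is closed under duality, while `L` and `dualL` are
exchanged. -/
theorem SmallOnTests.swap {δ : Q → Fin 2 → Q} (h : SmallOnTests δ) :
    SmallOnTests fun q x => δ q (Equiv.swap a b x) where
  full x hx := by
    rw [deficiency_swap]
    exact h.full _ (by simpa [dual] using hx)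
  mem_W' x hx := by
    rw [deficiency_swap]
    exact h.mem_W' _ (dual_mem_W' x hx)
  mem_L := by
    obtain ⟨v, hv, h⟩ := h.mem_dualL
    exact ⟨dual v, hv, by rwa [deficiency_swap, dual_dual]⟩
  mem_dualL := by
    obtain ⟨u, hu, h⟩ := h.mem_L
    exact ⟨dual u, by rwa [mem_dualL_iff, dual_dual], by rwa [deficiency_swap, dual_dual]⟩

/-- The symbolic search succeeds for letters of the given shapes. -/
def Verified (s t : Shape) : Prop :=
  ∃ ws : List (List (Fin 2)), (∀ x ∈ ws, x.length = 3 ∨ x ∈ W') ∧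
    verify [regexL, regexDualL] guideWords s t ws = true

theorem Verified.deficiency_le [Finite Q] {s t : Shape} (h : Verified s t) {δ : Q → Fin 2 → Q}
    (hδ : SmallOnTests δ) (hs : s.Fits (δ · a)) (ht : t.Fits (δ · b)) (w : List (Fin 2)) :
    deficiency δ w ≤ 2 := by
  obtain ⟨ws, hws, hv⟩ := h
  rw [deficiency_eq]
  refine verify_sound hv hs ht ?_ ?_ w
  · simp only [List.mem_cons, List.not_mem_nil, or_false, forall_eq_or_imp, forall_eq,
      ← deficiency_eq]
    refine ⟨?_, ?_⟩
    · obtain ⟨u, hu, h⟩ := hδ.mem_L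
      exact ⟨u, matches_regexL ▸ hu, h⟩
    · obtain ⟨v, hv, h⟩ := hδ.mem_dualL
      exact ⟨v, mem_matches_regexDualL hv, h⟩
  · intro x hx
    rw [← deficiency_eq]
    exact (hws x hx).elim (hδ.full x) (hδ.mem_W' x)

/-- Interchanging the letters. -/
theorem Verified.deficiency_le_swap [Finite Q] {s t : Shape} (h : Verified s t)
    {δ : Q → Fin 2 → Q} (hδ : SmallOnTests δ) (hs : s.Fits (δ · b)) (ht : t.Fits (δ · a))
    (w : List (Fin 2)) : deficiency δ w ≤ 2 := by
  have := h.deficiency_le hδ.swap (by simpa using hs) (by simpa using ht) (dual w)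
  rwa [deficiency_swap, dual_dual] at this

/-- No tested word is needed: for two permutations the empty missing set is already closed under
both letters. -/
theorem verify_bijective_bijective : Verified bijectiveShape bijectiveShape :=
  ⟨[],
    by decide, by decide +kernel⟩

theorem verify_bijective_triple : Verified bijectiveShape tripleShape :=
  ⟨[[a, b, a, b, b, a, b, a],
      [b, a, a, b, a, b, a, a, b]],
    by decide, by decide +kernel⟩

theorem verify_bijective_twoPairs : Verified bijectiveShape twoPairsShape :=
  ⟨[[a, b, b, a, b, b, a],
      [b, a, a, b, a, b, a, a, b],
      [b, b, a, a, a, b]],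
    by decide, by decide +kernel⟩

theorem verify_bijective_innerPair : Verified bijectiveShape innerPairShape :=
  ⟨[[b, a, a, b, a, a, b],
      [a, b, b, a, b, a, b, b, a],
      [b, a, a, b, a, b, a, a, b],
      [b, a, a, b, b, a, a, b],
      [a, b, a, b, b, a, b, a],
      [b, a, b, a, a, a, b],
      [b, a, a, a, b, a, b],
      [b, a, a, a, b, a, a, a, b],
      [b, a, b, a, a, b, a, b]],
    by decide, by decide +kernel⟩

theorem verify_bijective_outerPair : Verified bijectiveShape outerPairShape :=
  ⟨[[a, b, b, b, a, b, b, b, a],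
      [a, b, b, a, b, a, b, b, a],
      [a, b, b, a, a, b, b, a],
      [b, a, a, b, a, b, a, a, b]],
    by decide, by decide +kernel⟩

theorem verify_triple_triple : Verified tripleShape tripleShape :=
  ⟨[[b, a, b]],
    by decide, by decide +kernel⟩

theorem verify_triple_twoPairs : Verified tripleShape twoPairsShape :=
  ⟨[[b, a, b]],
    by decide, by decide +kernel⟩

theorem verify_triple_innerPair : Verified tripleShape innerPairShape :=
  ⟨[[b, a, a, a, b, a, b],
      [a, b, b, a, b, a, b, b, a]],
    by decide, by decide +kernel⟩

theorem verify_triple_outerPair : Verified tripleShape outerPairShape :=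
  ⟨[[a, b, a, b, b, b, a],
      [b, a, a]],
    by decide, by decide +kernel⟩

theorem verify_twoPairs_twoPairs : Verified twoPairsShape twoPairsShape :=
  ⟨[[b, a, a, a, b, a, a, a, b]],
    by decide, by decide +kernel⟩

theorem verify_twoPairs_innerPair : Verified twoPairsShape innerPairShape :=
  ⟨[[b, a, a, a, b, a, a, a, b],
      [a, b, b, a, b, a, b, b, a],
      [a, b, b, b, a, b, a]],
    by decide, by decide +kernel⟩

theorem verify_twoPairs_outerPair : Verified twoPairsShape outerPairShape :=
  ⟨[[a, b, b, b, a, b, b, b, a],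
      [b, a, b, a, a, a, b]],
    by decide, by decide +kernel⟩

theorem verify_innerPair_innerPair : Verified innerPairShape innerPairShape :=
  ⟨[[b, a, a, b, a, b, a, a, b],
      [b, a, b],
      [a, b, b, a, b, b, a],
      [a, b, b, a, a, b, b, a]],
    by decide, by decide +kernel⟩

theorem verify_innerPair_outerPair : Verified innerPairShape outerPairShape :=
  ⟨[[a, b, b, b, a, b, b, b, a],
      [a, b, b, a, b, a, b, b, a],
      [a, b, a],
      [a, b, b, a, a, b, b, a]],
    by decide, by decide +kernel⟩

theorem verify_outerPair_outerPair : Verified outerPairShape outerPairShape :=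
  ⟨[[b, a, a, b, b, a, a, b],
      [b, a, a, a, b, a, a, a, b],
      [a, b, b, b, a, b, b, b, a],
      [b, a, b]],
    by decide, by decide +kernel⟩

theorem SmallOnTests.deficiency_le [Finite Q] {δ : Q → Fin 2 → Q} (hδ : SmallOnTests δ)
    (w : List (Fin 2)) : deficiency δ w ≤ 2 := by
  rcases isEmpty_or_nonempty Q with hQ | hQ
  -- The empty automaton is treated apart because naming states requires at least one.
  · simp [deficiency]
  have hsq : ∀ x, (missing δ [x, x]).ncard ≤ 2 := fun x => by
    rw [← deficiency_eq]
    -- The square of a letter is a prefix of its cube, which is among the words of length three.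
    exact (deficiency_le_append_right δ [x, x] [x]).trans (hδ.full _ rfl)
  rcases exists_shape (hsq a) with h | h | h | h | h <;>
    rcases exists_shape (hsq b) with h' | h' | h' | h' | h'
  · exact verify_bijective_bijective.deficiency_le hδ h h' w
  · exact verify_bijective_triple.deficiency_le hδ h h' w
  · exact verify_bijective_twoPairs.deficiency_le hδ h h' w
  · exact verify_bijective_innerPair.deficiency_le hδ h h' w
  · exact verify_bijective_outerPair.deficiency_le hδ h h' w
  · exact verify_bijective_triple.deficiency_le_swap hδ h' h w
  · exact verify_triple_triple.deficiency_le hδ h h' w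
  · exact verify_triple_twoPairs.deficiency_le hδ h h' w
  · exact verify_triple_innerPair.deficiency_le hδ h h' w
  · exact verify_triple_outerPair.deficiency_le hδ h h' w
  · exact verify_bijective_twoPairs.deficiency_le_swap hδ h' h w
  · exact verify_triple_twoPairs.deficiency_le_swap hδ h' h w
  · exact verify_twoPairs_twoPairs.deficiency_le hδ h h' w
  · exact verify_twoPairs_innerPair.deficiency_le hδ h h' w
  · exact verify_twoPairs_outerPair.deficiency_le hδ h h' w
  · exact verify_bijective_innerPair.deficiency_le_swap hδ h' h w
  · exact verify_triple_innerPair.deficiency_le_swap hδ h' h w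
  · exact verify_twoPairs_innerPair.deficiency_le_swap hδ h' h w
  · exact verify_innerPair_innerPair.deficiency_le hδ h h' w
  · exact verify_innerPair_outerPair.deficiency_le hδ h h' w
  · exact verify_bijective_outerPair.deficiency_le_swap hδ h' h w
  · exact verify_triple_outerPair.deficiency_le_swap hδ h' h w
  · exact verify_twoPairs_outerPair.deficiency_le_swap hδ h' h w
  · exact verify_innerPair_outerPair.deficiency_le_swap hδ h' h w
  · exact verify_outerPair_outerPair.deficiency_le hδ h h' w

theorem isCollapsing_of_factors {u v w : List (Fin 2)} (hu : u ∈ L) (hv : v ∈ dualL)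
    (hfull : IsFull 3 w) (hW : ∀ x ∈ W', x <:+: w) (huw : u <:+: w) (hvw : v <:+: w) :
    IsCollapsing 3 w := by
  have hne : w ≠ [] := by
    rintro rfl
    simpa using hfull [a, a, a] rfl
  refine ⟨hne, fun Q _ δ ⟨x, _, hx⟩ => ⟨hne, ?_⟩⟩
  by_contra! hlt
  have hle : ∀ y, y <:+: w → deficiency δ y ≤ 2 := fun y hy =>
    (deficiency_le_of_infix δ hy).trans (Nat.le_of_lt_succ hlt)
  have hδ : SmallOnTests δ :=
    ⟨fun y hy => hle y (hfull y hy), fun y hy => hle y (hW y hy), ⟨u, hu, hle u huw⟩,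
      ⟨v, hv, hle v hvw⟩⟩
  have := hδ.deficiency_le x
  omega

theorem mem_L_of_rmatch {w : List (Fin 2)} (h : regexL.rmatch w = true) : w ∈ L := by
  rwa [← matches_regexL, ← rmatch_iff_matches']

theorem isFull_w₃ : IsFull 3 w₃ := by
  intro x hx
  obtain ⟨p, q, r, rfl⟩ := List.length_eq_three.1 hx
  revert p q r
  decide

end CollapsingWords

theorem mainTheorem1 :
    (∀ w : List (Fin 2), CollapsingWords.IsFull 3 w →
      (∀ x ∈ CollapsingWords.W, x <:+: w) → CollapsingWords.IsCollapsing 3 w) ∧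
    (∀ u ∈ CollapsingWords.L, ∀ v ∈ CollapsingWords.dualL,
      ∀ w : List (Fin 2), CollapsingWords.IsFull 3 w →
        (∀ x ∈ CollapsingWords.W', x <:+: w) → u <:+: w → v <:+: w →
          CollapsingWords.IsCollapsing 3 w) ∧
    (CollapsingWords.w₃.length = 53 ∧
      CollapsingWords.IsFull 3 CollapsingWords.w₃ ∧
      (∀ x ∈ CollapsingWords.W', x <:+: CollapsingWords.w₃) ∧
      CollapsingWords.u ∈ CollapsingWords.L ∧ CollapsingWords.u <:+: CollapsingWords.w₃ ∧
      CollapsingWords.v ∈ CollapsingWords.dualL ∧ CollapsingWords.v <:+: CollapsingWords.w₃ ∧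
      CollapsingWords.IsCollapsing 3 CollapsingWords.w₃) ∧
    CollapsingWords.c 3 2 ≤ 53 := by
  have hW : ∀ x ∈ CollapsingWords.W', x <:+: CollapsingWords.w₃ := by decide
  have hu : CollapsingWords.u ∈ CollapsingWords.L := CollapsingWords.mem_L_of_rmatch (by decide)
  -- Membership in `dualL` is by definition membership of the dual word in `L`, so the same matcher
  -- applies.
  have hv : CollapsingWords.v ∈ CollapsingWords.dualL := CollapsingWords.mem_L_of_rmatch (by decide)
  have huw : CollapsingWords.u <:+: CollapsingWords.w₃ := by decide
  have hvw : CollapsingWords.v <:+: CollapsingWords.w₃ := by decide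
  have hcol : CollapsingWords.IsCollapsing 3 CollapsingWords.w₃ :=
    CollapsingWords.isCollapsing_of_factors hu hv CollapsingWords.isFull_w₃ hW huw hvw
  refine ⟨fun w hfull hw => ?_, fun u hu v hv w hfull hw huw hvw =>
    CollapsingWords.isCollapsing_of_factors hu hv hfull hw huw hvw,
    ⟨rfl, CollapsingWords.isFull_w₃, hW, hu, huw, hv, hvw, hcol⟩, ?_⟩
  · refine CollapsingWords.isCollapsing_of_factors
      -- The two words of `W` outside `W'` serve as `u` and `v`: `b²a³b² = b·ba·a·ab·b` lies in `L`
      -- with all stars empty, and `a²b³a²` is its dual.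
      (u := [1, 1, 0, 0, 0, 1, 1]) (v := [0, 0, 1, 1, 1, 0, 0])
      (CollapsingWords.mem_L_of_rmatch (by decide)) (CollapsingWords.mem_L_of_rmatch (by decide))
      hfull (fun x hx => hw x (Finset.mem_sdiff.1 hx).1) (hw _ (by decide)) (hw _ (by decide))
  · exact iInf₂_le CollapsingWords.w₃ hcol
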